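/- Fix a cutoff $\chi\in C_0^\infty(\mathbb R)$ with $0\le\chi\le1$, $\chi=1$ on $[-1,1]$ and $\operatorname{supp}\chi\subset[-2,2]$, and put $\rho(s)=\chi(s)-\chi(2s)$. For $f:\mathbb R^2\to\mathbb C$ let $\hat f(\xi)=(2\pi)^{-2}\int_{\mathbb R^2}e^{-ix\cdot\xi}f(x)\,dx$, and for $\Lambda\in2^{\mathbb Z}$ let $P_\Lambda$ be the frequency projection $\widehat{P_\Lambda f}(\xi)=\rho(|\xi|/\Lambda)\hat f(\xi)$. For $\beta\in\{0,1\}$ let $$m_\beta(r)=r\,(1+\beta r^2)^{1/2}\Big(\frac{\tanh r}{r}\Big)^{1/2},\qquad [S_{m_\beta}(t)f](x)=\int_{\mathbb R^2}e^{ix\cdot\xi+it\,\mathrm{sgn}(\xi_1)m_\beta(|\xi|)}\hat f(\xi)\,d\xi ,$$ where $\xi=(\xi_1,\xi_2)$, and write $\langle s\rangle=(1+|s|^2)^{1/2}$. **Theorem (localised dispersive estimate).** Let $\beta\in\{0,1\}$. Then there exists a constant $c_\beta>0$ (depending only on $\beta$ and on the fixed cutoff $\chi$) such that $$\|S_{m_\beta}(t)P_\Lambda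 f\|_{L^\infty_x(\mathbb R^2)}\le c_\beta\,\langle\sqrt\beta\,\Lambda\rangle^{-1}\langle\Lambda\rangle^{3/2}\,|t|^{-1}\,\|P_\Lambda f\|_{L^1_x(\mathbb R^2)}$$ for all $\Lambda\in2^{\mathbb Z}$, all real $t\ne0$ and all Schwartz functions $f\in\mathcal S(\mathbb R^2)$. -/

import Mathlib

open scoped ContDiff SchwartzMap

noncomputable section

namespace FDKP

/-- The plane `ℝ²` with its Euclidean norm and Lebesgue measure. -/
abbrev Plane : Type := EuclideanSpace ℝ (Fin 2)

/-- The Japanese bracket `⟨s⟩ = (1 + |s|²)^{1/2}` of a real number. -/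
def bracket (s : ℝ) : ℝ := Real.sqrt (1 + |s| ^ 2)

/-- The dispersive symbol `m_β(r) = r (1 + β r²)^{1/2} (tanh r / r)^{1/2}`, used for `r ≥ 0`.
The value at `r = 0` is `0`, the limit as `r → 0`. -/
def symbol (β r : ℝ) : ℝ :=
  r * Real.sqrt (1 + β * r ^ 2) * Real.sqrt (Real.tanh r / r)

/-- The Fourier transform in angular frequency, `f̂(ξ) = (2π)⁻² ∫ e^{-i x·ξ} f(x) dx`, normalised so
that the inversion formula is `f(x) = ∫ e^{i x·ξ} f̂(ξ) dξ`. -/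
def hat (f : Plane → ℂ) (ξ : Plane) : ℂ :=
  (((2 * Real.pi) ^ 2 : ℝ) : ℂ)⁻¹ *
    ∫ x : Plane, Complex.exp (-(Complex.I * ((inner ℝ x ξ : ℝ) : ℂ))) * f x

/-- The inverse Fourier transform `x ↦ ∫ e^{i x·ξ} g(ξ) dξ`. -/
def invHat (g : Plane → ℂ) (x : Plane) : ℂ :=
  ∫ ξ : Plane, Complex.exp (Complex.I * ((inner ℝ x ξ : ℝ) : ℂ)) * g ξ

/-- The linear propagator
`[S_m(t) f](x) = ∫ e^{i x·ξ + i t sgn(ξ₁) m(|ξ|)} f̂(ξ) dξ`. -/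
def propagator (m : ℝ → ℝ) (t : ℝ) (f : Plane → ℂ) (x : Plane) : ℂ :=
  ∫ ξ : Plane,
    Complex.exp (Complex.I * ((inner ℝ x ξ : ℝ) : ℂ)
        + Complex.I * ((t * Real.sign (ξ 0) * m ‖ξ‖ : ℝ) : ℂ))
      * hat f ξ

/-- Admissible cutoffs: `χ ∈ C₀^∞(ℝ)`, `0 ≤ χ ≤ 1`, `χ = 1` on `[-1,1]`, `supp χ ⊆ [-2,2]`. -/
structure IsCutoff (χ : ℝ → ℝ) : Prop where
  smooth : ContDiff ℝ ∞ χ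
  nonneg : ∀ s, 0 ≤ χ s
  le_one : ∀ s, χ s ≤ 1
  eq_one : ∀ s ∈ Set.Icc (-1 : ℝ) 1, χ s = 1
  support_subset : tsupport χ ⊆ Set.Icc (-2 : ℝ) 2

/-- `ρ(s) = χ(s) - χ(2s)`. -/
def rho (χ : ℝ → ℝ) (s : ℝ) : ℝ := χ s - χ (2 * s)

/-- The Littlewood-Paley projector `P_Λ` built from the cutoff `χ`: the Fourier multiplier with
symbol `ρ(|ξ|/Λ)`. -/
def lpProj (χ : ℝ → ℝ) (Λ : ℝ) (f : Plane → ℂ) : Plane → ℂ :=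
  invHat fun ξ => (rho χ (‖ξ‖ / Λ) : ℂ) * hat f ξ

end FDKP

end

/-! Since the right-hand side involves `P_Λ f` itself, only the frequency support of `P_Λ f`
matters: it lies in the annulus Λ/2 ≤ |ξ| ≤ 2Λ, so S(t)P_Λ f is (2π)⁻² times the convolution of `P_Λ
f` with the sharply truncated `kernel`. It suffices to bound this kernel pointwise
(`norm_kernel_le`), and no smooth cutoff is needed there.

In polar coordinates the jump of sgn ξ₁ splits the circle into two half circles, rotated by an angle
depending on x. On each one integrates r exp(i(R r sin ψ + t m(r))) in r and ψ, with |R| = |x|. Let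
m' ≥ μ and |m''| ≥ l² on the annulus. If |R| ≤ |t|μ/2, there is no radial stationary point and the
first derivative test gives Λ/(μ|t|). If |R| is larger, the second derivative test in r gives only
|t|^{-1/2}, and the angle must supply (|R|Λ)^{-1/2} ≲ (|t|μΛ)^{-1/2}, although the arcs end at
arbitrary angles. The substitution z = sin ψ and a shift of the contour into the upper half plane
turn the angular integral into vertical rays carrying exp(-R r y) and a weight of size at most
y^{-1/2}. For fixed y the r-integral is still oscillatory with the same m'', so both gains are
available at once (`norm_vertical_le`).

It remains to bound m' and m'' below. With q = m², m'' has the sign of 2qq'' - q'², negative for β =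
0 and positive for β = 1 (`symbol₂_zero_bound`, `symbol₂_one_bound`). Inserting these sizes makes
both Λ/μ and Λ/(l√(μΛ)) at most a constant times ⟨√βΛ⟩⁻¹⟨Λ⟩^{3/2}. -/

namespace FDKP

open Set MeasureTheory intervalIntegral

/-! ### Van der Corput estimates in one variable. -/

/-- First derivative test for oscillatory integrals. -/
theorem norm_integral_cexp_le_of_le_abs_deriv {φ φ₁ φ₂ : ℝ → ℝ} {a b μ : ℝ} (hab : a ≤ b)
    (hμ : 0 < μ) (h₁ : ∀ x ∈ Icc a b, HasDerivAt φ (φ₁ x) x)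
    (h₂ : ∀ x ∈ Icc a b, HasDerivAt φ₁ (φ₂ x) x) (hc : ContinuousOn φ₂ (Icc a b))
    (hpos : ∀ x ∈ Icc a b, 0 ≤ φ₂ x) (hlow : ∀ x ∈ Icc a b, μ ≤ |φ₁ x|) :
    ‖∫ x in a..b, Complex.exp (Complex.I * (φ x : ℂ))‖ ≤ 4 / μ := by
  have hne : ∀ x ∈ Icc a b, φ₁ x ≠ 0 := fun x hx h => by
    have := hlow x hx
    rw [h, abs_zero] at this
    linarith
  have hinv : ∀ x ∈ Icc a b, |(φ₁ x)⁻¹| ≤ μ⁻¹ := fun x hx => by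
    rw [abs_inv]
    exact inv_anti₀ hμ (hlow x hx)
  have hφ₁c : ContinuousOn φ₁ (Icc a b) := fun x hx => (h₂ x hx).continuousAt.continuousWithinAt
  have hφc : ContinuousOn φ (Icc a b) := fun x hx => (h₁ x hx).continuousAt.continuousWithinAt
  have hu' : ∀ x ∈ Icc a b, HasDerivAt (fun x => (φ₁ x)⁻¹) (-φ₂ x / φ₁ x ^ 2) x := fun x hx =>
    (h₂ x hx).inv (hne x hx)
  have hdc : ContinuousOn (fun x => -φ₂ x / φ₁ x ^ 2) (Icc a b) :=
    hc.neg.div (hφ₁c.pow 2) fun x hx => pow_ne_zero 2 (hne x hx)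
  have hec : ContinuousOn (fun x => Complex.exp (Complex.I * (φ x : ℂ))) (Icc a b) := by fun_prop
  have hnorm : ∀ x : ℝ, ‖Complex.exp (Complex.I * (φ x : ℂ))‖ = 1 := fun x =>
    Complex.norm_exp_I_mul_ofReal _
  have hparts := integral_mul_deriv_eq_deriv_mul (a := a) (b := b)
    (u := fun x => (((φ₁ x)⁻¹ : ℝ) : ℂ))
    (u' := fun x => ((-φ₂ x / φ₁ x ^ 2 : ℝ) : ℂ))
    (v := fun x => -Complex.I * Complex.exp (Complex.I * (φ x : ℂ)))
    (v' := fun x => (φ₁ x : ℂ) * Complex.exp (Complex.I * (φ x : ℂ)))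
    (fun x hx => (hu' x (by rwa [uIcc_of_le hab] at hx)).ofReal_comp)
    (fun x hx => by
      rw [uIcc_of_le hab] at hx
      have := ((((h₁ x hx).ofReal_comp).const_mul Complex.I).cexp).const_mul (-Complex.I)
      convert this using 1
      linear_combination ((φ₁ x : ℂ) * Complex.exp (Complex.I * (φ x : ℂ))) * Complex.I_mul_I)
    (by
      apply ContinuousOn.intervalIntegrable
      rw [uIcc_of_le hab]
      exact Complex.continuous_ofReal.comp_continuousOn hdc)
    (by
      apply ContinuousOn.intervalIntegrable
      rw [uIcc_of_le hab]
      exact (Complex.continuous_ofReal.comp_continuousOn hφ₁c).mul hec)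
  have hlhs : ∫ x in a..b, Complex.exp (Complex.I * (φ x : ℂ)) =
      ∫ x in a..b, (((φ₁ x)⁻¹ : ℝ) : ℂ) *
        ((φ₁ x : ℂ) * Complex.exp (Complex.I * (φ x : ℂ))) := by
    apply integral_congr
    intro x hx
    rw [uIcc_of_le hab] at hx
    have : (φ₁ x : ℂ) ≠ 0 := by exact_mod_cast hne x hx
    simp only [Complex.ofReal_inv]
    field_simp
  have hftc : ∫ x in a..b, -φ₂ x / φ₁ x ^ 2 = (φ₁ b)⁻¹ - (φ₁ a)⁻¹ :=
    integral_eq_sub_of_hasDerivAt (fun x hx => hu' x (by rwa [uIcc_of_le hab] at hx))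
      (ContinuousOn.intervalIntegrable (by rwa [uIcc_of_le hab]))
  -- As φ₂ ≥ 0, the derivative of 1/φ₁ has a constant sign, so its absolute integral telescopes to a
  -- difference of boundary values.
  have hrest : ‖∫ x in a..b, ((-φ₂ x / φ₁ x ^ 2 : ℝ) : ℂ) *
      (-Complex.I * Complex.exp (Complex.I * (φ x : ℂ)))‖ ≤ 2 / μ := by
    calc _ ≤ ∫ x in a..b, -(-φ₂ x / φ₁ x ^ 2) := by
          apply norm_integral_le_of_norm_le hab
          · refine Filter.Eventually.of_forall fun x hx => ?_
            have hx' := Ioc_subset_Icc_self hx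
            rw [norm_mul, norm_mul, hnorm, norm_neg, Complex.norm_I, Complex.norm_real,
              Real.norm_eq_abs, mul_one, mul_one, abs_of_nonpos]
            exact div_nonpos_of_nonpos_of_nonneg (by linarith [hpos x hx']) (sq_nonneg _)
          · exact (ContinuousOn.intervalIntegrable (by rwa [uIcc_of_le hab])).neg
      _ = (φ₁ a)⁻¹ - (φ₁ b)⁻¹ := by rw [intervalIntegral.integral_neg, hftc]; ring
      _ ≤ 2 / μ := by
          have := abs_le.1 (hinv a ⟨le_rfl, hab⟩)
          have := abs_le.1 (hinv b ⟨hab, le_rfl⟩)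
          rw [div_eq_mul_inv]
          linarith
  have hbd : ∀ x ∈ Icc a b, ‖(((φ₁ x)⁻¹ : ℝ) : ℂ) *
      (-Complex.I * Complex.exp (Complex.I * (φ x : ℂ)))‖ ≤ μ⁻¹ := fun x hx => by
    rw [norm_mul, norm_mul, hnorm, norm_neg, Complex.norm_I, Complex.norm_real, Real.norm_eq_abs,
      mul_one, mul_one]
    exact hinv x hx
  rw [hlhs, hparts]
  calc _ ≤ (μ⁻¹ + μ⁻¹) + 2 / μ :=
        (norm_sub_le _ _).trans (add_le_add ((norm_sub_le _ _).trans
          (add_le_add (hbd b ⟨hab, le_rfl⟩) (hbd a ⟨le_rfl, hab⟩))) hrest)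
    _ = 4 / μ := by rw [div_eq_mul_inv, div_eq_mul_inv]; ring

theorem norm_integral_cexp_le_sub {φ : ℝ → ℝ} {a b : ℝ} (hab : a ≤ b) :
    ‖∫ x in a..b, Complex.exp (Complex.I * (φ x : ℂ))‖ ≤ b - a := by
  have := intervalIntegral.norm_integral_le_of_norm_le_const (a := a) (b := b) (C := 1)
    (f := fun x => Complex.exp (Complex.I * (φ x : ℂ)))
    (fun x _ => (Complex.norm_exp_I_mul_ofReal _).le)
  rwa [one_mul, abs_of_nonneg (by linarith)] at this

theorem norm_integral_cexp_neg (φ : ℝ → ℝ) (a b : ℝ) :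
    ‖∫ x in a..b, Complex.exp (Complex.I * ((-φ x : ℝ) : ℂ))‖ =
      ‖∫ x in a..b, Complex.exp (Complex.I * (φ x : ℂ))‖ := by
  rw [← RCLike.norm_conj (∫ x in a..b, Complex.exp (Complex.I * (φ x : ℂ)))]
  congr 1
  rw [← intervalIntegral_conj]
  apply integral_congr
  intro x _
  simp only [← Complex.exp_conj]
  simp

/-- Starting from a nonnegative value, φ₁ grows at rate at least l². Discard an initial interval of
length 1/l trivially; beyond it φ₁ ≥ l and the first derivative test costs 4/l. -/
theorem norm_integral_cexp_le_of_deriv_nonneg {φ φ₁ φ₂ : ℝ → ℝ} {a b l : ℝ} (hab : a ≤ b)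
    (hl : 0 < l) (h₁ : ∀ x ∈ Icc a b, HasDerivAt φ (φ₁ x) x)
    (h₂ : ∀ x ∈ Icc a b, HasDerivAt φ₁ (φ₂ x) x) (hc : ContinuousOn φ₂ (Icc a b))
    (hlow : ∀ x ∈ Icc a b, l ^ 2 ≤ φ₂ x) (ha : 0 ≤ φ₁ a) :
    ‖∫ x in a..b, Complex.exp (Complex.I * (φ x : ℂ))‖ ≤ 5 / l := by
  have hgrow : ∀ x ∈ Icc a b, l ^ 2 * (x - a) ≤ φ₁ x := fun x hx => by
    have := (convex_Icc a b).mul_sub_le_image_sub_of_le_deriv (f := φ₁) (C := l ^ 2)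
      (fun y hy => (h₂ y hy).continuousAt.continuousWithinAt)
      (fun y hy => (h₂ y (interior_subset hy)).differentiableAt.differentiableWithinAt)
      (fun y hy => by
        rw [(h₂ y (interior_subset hy)).deriv]; exact hlow y (interior_subset hy))
      a ⟨le_rfl, hab⟩ x hx hx.1
    linarith
  rcases le_total b (a + 1 / l) with h | h
  · calc _ ≤ b - a := norm_integral_cexp_le_sub hab
      _ ≤ 1 / l := by linarith
      _ ≤ 5 / l := by gcongr; norm_num
  · have hl' : 0 < 1 / l := by positivity
    have hφc : ContinuousOn φ (Icc a b) := fun x hx => (h₁ x hx).continuousAt.continuousWithinAt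
    have hec : ContinuousOn (fun x => Complex.exp (Complex.I * (φ x : ℂ))) (Icc a b) := by
      fun_prop
    have hsub : Icc (a + 1 / l) b ⊆ Icc a b := Icc_subset_Icc_left (by linarith)
    rw [← integral_add_adjacent_intervals (b := a + 1 / l)
      (ContinuousOn.intervalIntegrable (hec.mono (by
        rw [uIcc_of_le (by linarith)]; exact Icc_subset_Icc_right h)))
      (ContinuousOn.intervalIntegrable (hec.mono (by rwa [uIcc_of_le h])))]
    refine (norm_add_le _ _).trans ?_
    have e1 := norm_integral_cexp_le_sub (φ := φ) (a := a) (b := a + 1 / l) (by linarith)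
    have e2 := norm_integral_cexp_le_of_le_abs_deriv h hl (fun x hx => h₁ x (hsub hx))
      (fun x hx => h₂ x (hsub hx)) (hc.mono hsub)
      (fun x hx => (sq_nonneg l).trans (hlow x (hsub hx)))
      (fun x hx => by
        refine le_trans ?_ (le_abs_self _)
        refine le_trans ?_ (hgrow x (hsub hx))
        have : 1 / l ≤ x - a := by linarith [hx.1]
        calc l = l ^ 2 * (1 / l) := by field_simp
          _ ≤ _ := by gcongr)
    calc _ ≤ (a + 1 / l - a) + 4 / l := add_le_add e1 e2
      _ = 5 / l := by ring

theorem norm_integral_cexp_le_of_deriv_nonpos {φ φ₁ φ₂ : ℝ → ℝ} {a b l : ℝ} (hab : a ≤ b)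
    (hl : 0 < l) (h₁ : ∀ x ∈ Icc a b, HasDerivAt φ (φ₁ x) x)
    (h₂ : ∀ x ∈ Icc a b, HasDerivAt φ₁ (φ₂ x) x) (hc : ContinuousOn φ₂ (Icc a b))
    (hlow : ∀ x ∈ Icc a b, l ^ 2 ≤ φ₂ x) (hb : φ₁ b ≤ 0) :
    ‖∫ x in a..b, Complex.exp (Complex.I * (φ x : ℂ))‖ ≤ 5 / l := by
  have hmem : ∀ x ∈ Icc (-b) (-a), -x ∈ Icc a b := fun x hx =>
    ⟨by linarith [hx.2], by linarith [hx.1]⟩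
  have := norm_integral_cexp_le_of_deriv_nonneg (φ := fun x => φ (-x)) (φ₁ := fun x => -φ₁ (-x))
    (φ₂ := fun x => φ₂ (-x)) (a := -b) (b := -a) (by linarith) hl
    (fun x hx => by
      have := (h₁ (-x) (hmem x hx)).comp x (hasDerivAt_neg x)
      simpa [Function.comp_def] using this)
    (fun x hx => by
      have := ((h₂ (-x) (hmem x hx)).comp x (hasDerivAt_neg x)).fun_neg
      simpa [Function.comp_def] using this)
    (hc.comp continuousOn_neg hmem) (fun x hx => hlow _ (hmem x hx)) (by simpa using hb)
  rwa [integral_comp_neg (fun x => Complex.exp (Complex.I * (φ x : ℂ))), neg_neg, neg_neg] at this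

/-- Second derivative test for oscillatory integrals. -/
theorem norm_integral_cexp_le_of_le_deriv2 {φ φ₁ φ₂ : ℝ → ℝ} {a b l : ℝ} (hab : a ≤ b)
    (hl : 0 < l) (h₁ : ∀ x ∈ Icc a b, HasDerivAt φ (φ₁ x) x)
    (h₂ : ∀ x ∈ Icc a b, HasDerivAt φ₁ (φ₂ x) x) (hc : ContinuousOn φ₂ (Icc a b))
    (hlow : ∀ x ∈ Icc a b, l ^ 2 ≤ φ₂ x) :
    ‖∫ x in a..b, Complex.exp (Complex.I * (φ x : ℂ))‖ ≤ 10 / l := by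
  have h510 : 5 / l ≤ 10 / l := by gcongr; norm_num
  rcases le_total 0 (φ₁ a) with ha | ha
  · exact (norm_integral_cexp_le_of_deriv_nonneg hab hl h₁ h₂ hc hlow ha).trans h510
  rcases le_total (φ₁ b) 0 with hb | hb
  · exact (norm_integral_cexp_le_of_deriv_nonpos hab hl h₁ h₂ hc hlow hb).trans h510
  -- Split at the stationary point; each side costs 5/l.
  obtain ⟨z, hz, hz0⟩ := intermediate_value_Icc hab
    (fun x hx => (h₂ x hx).continuousAt.continuousWithinAt : ContinuousOn φ₁ (Icc a b))
    (⟨ha, hb⟩ : (0 : ℝ) ∈ Icc (φ₁ a) (φ₁ b))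
  have hφc : ContinuousOn φ (Icc a b) := fun x hx => (h₁ x hx).continuousAt.continuousWithinAt
  have hec : ContinuousOn (fun x => Complex.exp (Complex.I * (φ x : ℂ))) (Icc a b) := by fun_prop
  have s1 : Icc a z ⊆ Icc a b := Icc_subset_Icc_right hz.2
  have s2 : Icc z b ⊆ Icc a b := Icc_subset_Icc_left hz.1
  rw [← integral_add_adjacent_intervals (b := z)
    (ContinuousOn.intervalIntegrable (hec.mono (by rwa [uIcc_of_le hz.1])))
    (ContinuousOn.intervalIntegrable (hec.mono (by rwa [uIcc_of_le hz.2])))]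
  refine (norm_add_le _ _).trans ((add_le_add
    (norm_integral_cexp_le_of_deriv_nonpos hz.1 hl (fun x hx => h₁ x (s1 hx))
      (fun x hx => h₂ x (s1 hx)) (hc.mono s1) (fun x hx => hlow x (s1 hx)) hz0.le)
    (norm_integral_cexp_le_of_deriv_nonneg hz.2 hl (fun x hx => h₁ x (s2 hx))
      (fun x hx => h₂ x (s2 hx)) (hc.mono s2) (fun x hx => hlow x (s2 hx)) hz0.ge)).trans
    (le_of_eq ?_))
  ring

/-- Inserting a `C¹` amplitude into an oscillatory integral. -/
theorem norm_integral_mul_le_of_primitive_bound {e : ℝ → ℂ} {ψ ψ₁ : ℝ → ℝ} {a b A B C : ℝ}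
    (hab : a ≤ b) (he : Continuous e) (hC : ∀ x ∈ Icc a b, ‖∫ y in a..x, e y‖ ≤ C)
    (hψ : ∀ x ∈ Icc a b, HasDerivAt ψ (ψ₁ x) x) (hψ₁ : ContinuousOn ψ₁ (Icc a b))
    (hA : |ψ b| ≤ A) (hB : ∀ x ∈ Icc a b, |ψ₁ x| ≤ B) :
    ‖∫ x in a..b, (ψ x : ℂ) * e x‖ ≤ (A + B * (b - a)) * C := by
  have hC0 : 0 ≤ C := (norm_nonneg _).trans (hC a ⟨le_rfl, hab⟩)
  have hA0 : 0 ≤ A := (abs_nonneg _).trans hA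
  have hparts := integral_mul_deriv_eq_deriv_mul (a := a) (b := b)
    (u := fun x => (ψ x : ℂ)) (u' := fun x => (ψ₁ x : ℂ)) (v := fun x => ∫ y in a..x, e y)
    (v' := e) (fun x hx => (hψ x (by rwa [uIcc_of_le hab] at hx)).ofReal_comp)
    (fun x _ => he.integral_hasStrictDerivAt a x |>.hasDerivAt)
    (by
      apply ContinuousOn.intervalIntegrable
      rw [uIcc_of_le hab]
      exact Complex.continuous_ofReal.comp_continuousOn hψ₁)
    (he.intervalIntegrable _ _)
  -- The primitive vanishes at `a`, so the amplitude has to be bounded pointwise only at `b`.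
  rw [hparts, integral_same, mul_zero, sub_zero]
  have e1 : ‖(ψ b : ℂ) * ∫ y in a..b, e y‖ ≤ A * C := by
    rw [norm_mul, Complex.norm_real, Real.norm_eq_abs]
    exact mul_le_mul hA (hC b ⟨hab, le_rfl⟩) (norm_nonneg _) hA0
  have e2 : ‖∫ x in a..b, (ψ₁ x : ℂ) * ∫ y in a..x, e y‖ ≤ (B * C) * |b - a| := by
    apply intervalIntegral.norm_integral_le_of_norm_le_const
    intro x hx
    rw [uIoc_of_le hab] at hx
    have hx := Ioc_subset_Icc_self hx
    rw [norm_mul, Complex.norm_real, Real.norm_eq_abs]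
    exact mul_le_mul (hB x hx) (hC x hx) (norm_nonneg _) ((abs_nonneg _).trans (hB x hx))
  rw [abs_of_nonneg (by linarith)] at e2
  calc _ ≤ A * C + (B * C) * (b - a) := (norm_sub_le _ _).trans (add_le_add e1 e2)
    _ = _ := by ring

end FDKP

/-! ### Inequalities for tanh, and lower bounds for the derivatives of the symbol. -/

namespace FDKP

open Set

theorem le_of_hasDerivAt_nonneg {f f' : ℝ → ℝ} (h : ∀ x, HasDerivAt f (f' x) x)
    (h0 : ∀ x, 0 < x → 0 ≤ f' x) {a b : ℝ} (ha : 0 ≤ a) (hab : a ≤ b) : f a ≤ f b := by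
  refine monotoneOn_of_deriv_nonneg (convex_Ici 0)
    (fun x _ => (h x).continuousAt.continuousWithinAt)
    (fun x _ => (h x).differentiableAt.differentiableWithinAt) (fun x hx => ?_)
    (mem_Ici.2 ha) (mem_Ici.2 (ha.trans hab)) hab
  rw [interior_Ici] at hx
  rw [(h x).deriv]
  exact h0 x hx

theorem hasDerivAt_tanh (x : ℝ) : HasDerivAt Real.tanh (1 - Real.tanh x ^ 2) x := by
  have h := (Real.hasDerivAt_sinh x).div (Real.hasDerivAt_cosh x) (Real.cosh_pos x).ne'
  have he : Real.tanh = Real.sinh / Real.cosh := funext Real.tanh_eq_sinh_div_cosh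
  rw [he]
  refine h.congr_deriv ?_
  have := (Real.cosh_pos x).ne'
  rw [← he, Real.tanh_eq_sinh_div_cosh]
  field_simp

theorem one_sub_tanh_sq (x : ℝ) : 1 - Real.tanh x ^ 2 = (Real.cosh x ^ 2)⁻¹ := by
  have := (Real.cosh_pos x).ne'
  rw [Real.tanh_eq_sinh_div_cosh]
  field_simp
  linarith [Real.cosh_sq x]

theorem tanh_pos {x : ℝ} (hx : 0 < x) : 0 < Real.tanh x := by
  rw [Real.tanh_eq_sinh_div_cosh]
  exact div_pos (Real.sinh_pos_iff.2 hx) (Real.cosh_pos x)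

theorem one_sub_tanh_sq_pos (x : ℝ) : 0 < 1 - Real.tanh x ^ 2 := by
  linarith [Real.tanh_sq_lt_one x]

theorem tanh_le_self {x : ℝ} (hx : 0 ≤ x) : Real.tanh x ≤ x := by
  have := le_of_hasDerivAt_nonneg (f := fun x => x - Real.tanh x)
    (f' := fun x => 1 - (1 - Real.tanh x ^ 2))
    (fun x => (hasDerivAt_id x).sub (hasDerivAt_tanh x))
    (fun x _ => by nlinarith [sq_nonneg (Real.tanh x)]) le_rfl hx
  simpa using this

/-- After clearing denominators this is exp(2x) ≥ 1 + 2x. -/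
theorem div_one_add_le_tanh {x : ℝ} (hx : 0 ≤ x) : x / (1 + x) ≤ Real.tanh x := by
  have h1 := Real.add_one_le_exp (2 * x)
  have hE : Real.exp (2 * x) = Real.exp x * Real.exp x := by rw [← Real.exp_add]; ring_nf
  have hp := Real.exp_pos x
  have hi : Real.exp (-x) * Real.exp x = 1 := by rw [← Real.exp_add]; simp
  have hn := Real.exp_pos (-x)
  rw [Real.tanh_eq, div_le_div_iff₀ (by linarith) (by linarith)]
  have : 0 ≤ Real.exp (-x) * (Real.exp x * Real.exp x - (2 * x + 1)) :=
    mul_nonneg hn.le (by linarith)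
  have h3 : Real.exp (-x) * (Real.exp x * Real.exp x) = Real.exp x := by
    rw [← mul_assoc, hi, one_mul]
  nlinarith

/-- `tanh r - r sech² r` is nondecreasing. -/
theorem tanh_sub_mul_mono {a b : ℝ} (ha : 0 ≤ a) (hab : a ≤ b) :
    Real.tanh a - a * (1 - Real.tanh a ^ 2) ≤ Real.tanh b - b * (1 - Real.tanh b ^ 2) := by
  refine le_of_hasDerivAt_nonneg (f := fun x => Real.tanh x - x * (1 - Real.tanh x ^ 2))
    (f' := fun x => 2 * x * Real.tanh x * (1 - Real.tanh x ^ 2)) (fun x => ?_) (fun x hx => ?_)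
    ha hab
  · have h := hasDerivAt_tanh x
    have := h.sub ((hasDerivAt_id x).mul ((h.pow 2).const_sub 1))
    refine this.congr_deriv ?_
    simp
    ring
  · have := tanh_pos hx
    have := one_sub_tanh_sq_pos x
    positivity

/-- The constant 2/3 matches the leading Taylor term 2x³/3 at 0. With T = tanh x and S = 1 - T², the
difference of the two sides has derivative (2/3)xS(x - T) + (4/3)xT³. -/
theorem tanh_sub_mul_le {x : ℝ} (hx : 0 ≤ x) :
    Real.tanh x - x * (1 - Real.tanh x ^ 2) ≤ 2 / 3 * x ^ 2 * Real.tanh x := by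
  have := le_of_hasDerivAt_nonneg
    (f := fun x => 2 / 3 * x ^ 2 * Real.tanh x - (Real.tanh x - x * (1 - Real.tanh x ^ 2)))
    (f' := fun x => 4 / 3 * x * Real.tanh x + 2 / 3 * x ^ 2 * (1 - Real.tanh x ^ 2) -
      2 * x * Real.tanh x * (1 - Real.tanh x ^ 2)) (fun x => ?_) (fun x hx => ?_) le_rfl hx
  · simp at this
    linarith
  · have h := hasDerivAt_tanh x
    have := ((((hasDerivAt_id x).pow 2).const_mul (2 / 3)).mul h).sub
      (h.sub ((hasDerivAt_id x).mul ((h.pow 2).const_sub 1)))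
    refine this.congr_deriv ?_
    simp
    ring
  · have h1 := tanh_pos hx
    have h2 := one_sub_tanh_sq_pos x
    have h3 := tanh_le_self hx.le
    have h4 : 0 ≤ x * (x - Real.tanh x) * (1 - Real.tanh x ^ 2) := by
      have : 0 ≤ x - Real.tanh x := by linarith
      positivity
    have h5 : 0 ≤ x * Real.tanh x * Real.tanh x ^ 2 := by positivity
    nlinarith

theorem tanh_sub_mul_pos {x : ℝ} (hx : 0 < x) : 0 < Real.tanh x - x * (1 - Real.tanh x ^ 2) := by
  have hc := Real.one_le_cosh x
  have hs := Real.self_lt_sinh_iff.2 hx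
  rw [one_sub_tanh_sq, Real.tanh_eq_sinh_div_cosh]
  have : Real.sinh x / Real.cosh x - x * (Real.cosh x ^ 2)⁻¹ =
      (Real.sinh x * Real.cosh x - x) / Real.cosh x ^ 2 := by
    field_simp
  rw [this]
  apply div_pos _ (by positivity)
  nlinarith

theorem add_cube_le_sinh {x : ℝ} (hx : 0 ≤ x) : x + x ^ 3 / 6 ≤ Real.sinh x := by
  have := le_of_hasDerivAt_nonneg (f := fun x => Real.sinh x - (x + x ^ 3 / 6))
    (f' := fun x => Real.cosh x - (1 + x ^ 2 / 2)) (fun x => ?_) (fun x hx => ?_) le_rfl hx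
  · simp at this
    linarith
  · have := (Real.hasDerivAt_sinh x).sub
      ((hasDerivAt_id x).add (((hasDerivAt_id x).pow 3).div_const 6))
    refine this.congr_deriv ?_
    simp
    ring
  · have h1 := Real.cosh_two_mul (x / 2)
    have h2 := Real.cosh_sq (x / 2)
    have h3 : x / 2 ≤ Real.sinh (x / 2) := Real.self_le_sinh_iff.2 (by positivity)
    rw [mul_div_cancel₀ x two_ne_zero] at h1
    nlinarith

/-- The half-angle formula and the cubic bound for sinh give the quartic Taylor lower bound for
cosh; what remains is polynomial in x². The form needed later is (1 + r²)² sech² r ≤ 2. -/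
theorem one_add_sq_sq_le_cosh_sq {x : ℝ} (hx : 0 ≤ x) : (1 + x ^ 2) ^ 2 ≤ 2 * Real.cosh x ^ 2 := by
  have hcosh : 1 + x ^ 2 / 2 + x ^ 4 / 24 ≤ Real.cosh x := by
    have h1 := Real.cosh_two_mul (x / 2)
    have h2 := Real.cosh_sq (x / 2)
    have h3 := add_cube_le_sinh (x := x / 2) (by positivity)
    rw [mul_div_cancel₀ x two_ne_zero] at h1
    have h4 : (x / 2 + (x / 2) ^ 3 / 6) ^ 2 ≤ Real.sinh (x / 2) ^ 2 := by gcongr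
    have h5 : 0 ≤ x ^ 6 := by positivity
    nlinarith
  have h1 : (1 + x ^ 2 / 2 + x ^ 4 / 24) ^ 2 ≤ Real.cosh x ^ 2 := by gcongr
  have hy0 : 0 ≤ x ^ 2 := sq_nonneg x
  have e4 : x ^ 4 = (x ^ 2) ^ 2 := by ring
  rw [e4] at h1
  set y := x ^ 2
  have h2 : 0 ≤ y * (y - 2) ^ 2 := by positivity
  have h3 : 0 ≤ y ^ 4 := by positivity
  nlinarith

/-- The square of the symbol. -/
noncomputable def symbolSq (β r : ℝ) : ℝ := (r + β * r ^ 3) * Real.tanh r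

/-- First derivative of `symbolSq`. -/
noncomputable def symbolSq₁ (β r : ℝ) : ℝ :=
  (1 + 3 * β * r ^ 2) * Real.tanh r + (r + β * r ^ 3) * (1 - Real.tanh r ^ 2)

/-- Second derivative of `symbolSq`. -/
noncomputable def symbolSq₂ (β r : ℝ) : ℝ :=
  6 * β * r * Real.tanh r + 2 * (1 + 3 * β * r ^ 2) * (1 - Real.tanh r ^ 2) -
    2 * (r + β * r ^ 3) * Real.tanh r * (1 - Real.tanh r ^ 2)

theorem hasDerivAt_symbolSq (β r : ℝ) : HasDerivAt (symbolSq β) (symbolSq₁ β r) r := by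
  have h := hasDerivAt_tanh r
  have := ((hasDerivAt_id r).add (((hasDerivAt_id r).pow 3).const_mul β)).mul h
  refine this.congr_deriv ?_
  simp [symbolSq₁]
  left
  ring

theorem hasDerivAt_symbolSq₁ (β r : ℝ) : HasDerivAt (symbolSq₁ β) (symbolSq₂ β r) r := by
  have h := hasDerivAt_tanh r
  have := (((((hasDerivAt_id r).pow 2).const_mul (3 * β)).const_add 1).mul h).add
    (((hasDerivAt_id r).add (((hasDerivAt_id r).pow 3).const_mul β)).mul
      ((h.pow 2).const_sub 1))
  refine this.congr_deriv ?_
  simp [symbolSq₂]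
  ring

theorem continuous_tanh : Continuous Real.tanh :=
  continuous_iff_continuousAt.2 fun x => (hasDerivAt_tanh x).continuousAt

theorem continuous_symbolSq₂ (β : ℝ) : Continuous (symbolSq₂ β) := by
  have := continuous_tanh
  unfold symbolSq₂
  fun_prop

/-- First derivative of the symbol. -/
noncomputable def symbol₁ (β r : ℝ) : ℝ := symbolSq₁ β r / (2 * √(symbolSq β r))

/-- Second derivative of the symbol. -/
noncomputable def symbol₂ (β r : ℝ) : ℝ :=
  (2 * symbolSq β r * symbolSq₂ β r - symbolSq₁ β r ^ 2) / (4 * symbolSq β r * √(symbolSq β r))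

theorem symbolSq_pos {β r : ℝ} (hβ : 0 ≤ β) (hr : 0 < r) : 0 < symbolSq β r := by
  have := tanh_pos hr
  unfold symbolSq
  positivity

/-- The square of the symbol is polynomial in r and tanh r, so all differentiation is done on it and
transferred through a single square root. -/
theorem symbol_eq_sqrt {β r : ℝ} (hβ : 0 ≤ β) (hr : 0 < r) : symbol β r = √(symbolSq β r) := by
  have hT := tanh_pos hr
  rw [symbol, symbolSq, mul_assoc, ← Real.sqrt_mul (by positivity)]
  nth_rw 1 [← Real.sqrt_sq hr.le]
  rw [← Real.sqrt_mul (by positivity)]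
  congr 1
  field_simp

theorem symbol_eq_sqrt_of_nonneg {β r : ℝ} (hβ : 0 ≤ β) (hr : 0 ≤ r) :
    symbol β r = √(symbolSq β r) := by
  rcases hr.eq_or_lt with rfl | h
  · simp [symbol, symbolSq]
  · exact symbol_eq_sqrt hβ h

theorem continuous_symbolSq (β : ℝ) : Continuous (symbolSq β) :=
  continuous_iff_continuousAt.2 fun x => (hasDerivAt_symbolSq β x).continuousAt

theorem hasDerivAt_sqrt_symbolSq {β r : ℝ} (hβ : 0 ≤ β) (hr : 0 < r) :
    HasDerivAt (fun r => √(symbolSq β r)) (symbol₁ β r) r :=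
  (hasDerivAt_symbolSq β r).sqrt (symbolSq_pos hβ hr).ne'

theorem hasDerivAt_symbol₁ {β r : ℝ} (hβ : 0 ≤ β) (hr : 0 < r) :
    HasDerivAt (symbol₁ β) (symbol₂ β r) r := by
  have hq := symbolSq_pos hβ hr
  have hs : 0 < √(symbolSq β r) := Real.sqrt_pos.2 hq
  have := (hasDerivAt_symbolSq₁ β r).div
    (((hasDerivAt_symbolSq β r).sqrt hq.ne').const_mul 2) (by positivity)
  refine this.congr_deriv ?_
  rw [symbol₂]
  have h2 : √(symbolSq β r) ^ 2 = symbolSq β r := Real.sq_sqrt hq.le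
  generalize √(symbolSq β r) = s at *
  rw [← h2]
  field_simp
  ring

theorem continuousOn_symbol₂ {β : ℝ} (hβ : 0 ≤ β) : ContinuousOn (symbol₂ β) (Ioi 0) := by
  have h0 := continuous_symbolSq β
  have h1 : Continuous (symbolSq₁ β) :=
    continuous_iff_continuousAt.2 fun x => (hasDerivAt_symbolSq₁ β x).continuousAt
  have h2 := continuous_symbolSq₂ β
  refine ContinuousOn.div (by fun_prop) (by fun_prop) fun x hx => ?_
  have := symbolSq_pos hβ hx
  positivity

/-- Drop all of q' except (1 + βr²) tanh r, which equals √(1 + βr²) √(tanh r / r) √q, and divide by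
2√q. -/
theorem sqrt_mul_sqrt_le_symbol₁ {β r : ℝ} (hβ : 0 ≤ β) (hr : 0 < r) :
    1 / 2 * √(1 + β * r ^ 2) * √(Real.tanh r / r) ≤ symbol₁ β r := by
  have hT := tanh_pos hr
  have hS := one_sub_tanh_sq_pos r
  have hq := symbolSq_pos hβ hr
  rw [symbol₁, le_div_iff₀ (by positivity), mul_assoc (1 / 2 : ℝ),
    ← Real.sqrt_mul (by positivity)]
  have : √((1 + β * r ^ 2) * (Real.tanh r / r)) * √(symbolSq β r) =
      (1 + β * r ^ 2) * Real.tanh r := by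
    rw [← Real.sqrt_mul (by positivity)]
    rw [show (1 + β * r ^ 2) * (Real.tanh r / r) * symbolSq β r =
      ((1 + β * r ^ 2) * Real.tanh r) ^ 2 by rw [symbolSq]; field_simp]
    exact Real.sqrt_sq (by positivity)
  rw [symbolSq₁]
  have h1 : 0 ≤ β * r ^ 2 * Real.tanh r := by positivity
  have h2 : 0 ≤ (r + β * r ^ 3) * (1 - Real.tanh r ^ 2) := by positivity
  linarith

/-- Reduction of a lower bound for the second derivative to one for its numerator. -/
theorem le_div_symbolSq {β r c N : ℝ} (hβ : 0 ≤ β) (hr : 0 < r)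
    (hN : 4 * c * (r * Real.tanh r * (1 + β * r ^ 2)) ^ 2 ≤ N * (1 + r ^ 2)) :
    c * (√(Real.tanh r / r) * r * √(1 + β * r ^ 2) / (1 + r ^ 2)) ≤
      N / (4 * symbolSq β r * √(symbolSq β r)) := by
  have hT := tanh_pos hr
  have hq := symbolSq_pos hβ hr
  have hs : 0 < √(symbolSq β r) := Real.sqrt_pos.2 hq
  have h1 : √(Real.tanh r / r) * √(1 + β * r ^ 2) * √(symbolSq β r) =
      (1 + β * r ^ 2) * Real.tanh r := by
    rw [← Real.sqrt_mul (by positivity), ← Real.sqrt_mul (by positivity)]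
    rw [show Real.tanh r / r * (1 + β * r ^ 2) * symbolSq β r =
      ((1 + β * r ^ 2) * Real.tanh r) ^ 2 by rw [symbolSq]; field_simp]
    exact Real.sqrt_sq (by positivity)
  rw [le_div_iff₀ (by positivity), ← mul_div_assoc, div_mul_eq_mul_div, div_le_iff₀ (by positivity)]
  calc _ = 4 * c * r * symbolSq β r *
        (√(Real.tanh r / r) * √(1 + β * r ^ 2) * √(symbolSq β r)) := by ring
    _ = 4 * c * (r * Real.tanh r * (1 + β * r ^ 2)) ^ 2 := by rw [h1, symbolSq]; ring
    _ ≤ _ := hN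

/-- With T = tanh r, S = 1 - T² and E = T - rS, the negated numerator is exactly E² + 4(rT)²S, so
the symbol is concave. For r ≤ 1 the second term suffices because S ≥ sech² 1; for r ≥ 1 it
degenerates, but E is nondecreasing and stays above its value at 1. -/
theorem symbol₂_zero_bound : ∃ c : ℝ, 0 < c ∧ ∀ r, 0 < r →
    c * (√(Real.tanh r / r) * r * √(1 + 0 * r ^ 2) / (1 + r ^ 2)) ≤ -symbol₂ 0 r := by
  set S₁ := 1 - Real.tanh 1 ^ 2 with hS₁
  set E₁ := Real.tanh 1 - 1 * (1 - Real.tanh 1 ^ 2) with hE₁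
  have hS₁pos : 0 < S₁ := one_sub_tanh_sq_pos 1
  have hE₁pos : 0 < E₁ := tanh_sub_mul_pos one_pos
  refine ⟨min S₁ (E₁ ^ 2 / 4), lt_min hS₁pos (by positivity), fun r hr => ?_⟩
  have hT := tanh_pos hr
  have hT1 := Real.tanh_lt_one r
  have hS := one_sub_tanh_sq_pos r
  rw [symbol₂, ← neg_div]
  refine le_div_symbolSq le_rfl hr ?_
  have hnum : -(2 * symbolSq 0 r * symbolSq₂ 0 r - symbolSq₁ 0 r ^ 2) =
      (Real.tanh r - r * (1 - Real.tanh r ^ 2)) ^ 2 +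
        4 * (r * Real.tanh r) ^ 2 * (1 - Real.tanh r ^ 2) := by
    simp only [symbolSq, symbolSq₁, symbolSq₂]
    ring
  rw [hnum, zero_mul, add_zero, mul_one]
  rcases le_total r 1 with h | h
  · have hmono : S₁ ≤ 1 - Real.tanh r ^ 2 := by
      rw [hS₁, one_sub_tanh_sq, one_sub_tanh_sq]
      gcongr
      exact Real.cosh_le_cosh.2 (by rwa [abs_of_pos hr, abs_one])
    calc _ ≤ 4 * (1 - Real.tanh r ^ 2) * (r * Real.tanh r) ^ 2 := by
          gcongr
          exact (min_le_left _ _).trans hmono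
      _ ≤ _ := by
          have h1 : 0 ≤ (Real.tanh r - r * (1 - Real.tanh r ^ 2)) ^ 2 * (1 + r ^ 2) := by positivity
          have h2 : 0 ≤ 4 * (1 - Real.tanh r ^ 2) * (r * Real.tanh r) ^ 2 * r ^ 2 := by positivity
          linarith
  · have hmono := tanh_sub_mul_mono zero_le_one h
    rw [← hE₁] at hmono
    calc _ ≤ 4 * (E₁ ^ 2 / 4) * (r * 1) ^ 2 := by
          gcongr
          exact min_le_right _ _
      _ ≤ (Real.tanh r - r * (1 - Real.tanh r ^ 2)) ^ 2 * (1 + r ^ 2) := by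
          rw [mul_div_cancel₀ _ four_ne_zero, mul_one]
          gcongr
          linarith
      _ ≤ _ := by gcongr; exact le_add_of_nonneg_right (by positivity)

/-- Here the numerator is a positive main term minus two terms in E = T - rS. The bound (1 + r²)²S ≤
2 keeps the main term at least 4r²T²(1 + 2r²), and E ≤ min(1, 2r²/3)·T controls the losses. -/
theorem symbol₂_one_bound (r : ℝ) (hr : 0 < r) :
    1 / 8 * (√(Real.tanh r / r) * r * √(1 + 1 * r ^ 2) / (1 + r ^ 2)) ≤ symbol₂ 1 r := by
  have hT := tanh_pos hr
  have hS := one_sub_tanh_sq_pos r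
  refine le_div_symbolSq zero_le_one hr ?_
  obtain ⟨E, hE⟩ : ∃ E, E = Real.tanh r - r * (1 - Real.tanh r ^ 2) := ⟨_, rfl⟩
  have hE0 : 0 < E := hE ▸ tanh_sub_mul_pos hr
  have hE1 : E ≤ Real.tanh r := by rw [hE]; nlinarith
  have hE2 : E ≤ 2 / 3 * r ^ 2 * Real.tanh r := hE ▸ tanh_sub_mul_le hr.le
  have hpS : (1 + r ^ 2) ^ 2 * (1 - Real.tanh r ^ 2) ≤ 2 := by
    rw [one_sub_tanh_sq, ← div_eq_mul_inv, div_le_iff₀ (by have := Real.cosh_pos r; positivity)]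
    exact one_add_sq_sq_le_cosh_sq hr.le
  have hnum : 2 * symbolSq 1 r * symbolSq₂ 1 r - symbolSq₁ 1 r ^ 2 =
      4 * r ^ 2 * Real.tanh r ^ 2 * (3 + 2 * r ^ 2 - (1 + r ^ 2) ^ 2 * (1 - Real.tanh r ^ 2)) -
        4 * r ^ 2 * (1 + r ^ 2) * (E * Real.tanh r) - (1 + r ^ 2) ^ 2 * E ^ 2 := by
    simp only [symbolSq, symbolSq₁, symbolSq₂, hE]
    ring
  have key : 1 / 2 * Real.tanh r ^ 2 * (r ^ 2 * (1 + r ^ 2)) ≤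
      2 * symbolSq 1 r * symbolSq₂ 1 r - symbolSq₁ 1 r ^ 2 := by
    rw [hnum]
    clear hnum hE
    set T := Real.tanh r
    set y := r ^ 2 with hy
    have hy0 : 0 < y := by positivity
    have h1 : 4 * y * T ^ 2 * (1 + 2 * y) ≤
        4 * y * T ^ 2 * (3 + 2 * y - (1 + y) ^ 2 * (1 - T ^ 2)) := by
      gcongr
      linarith
    -- At y = 3/2 the two bounds E ≤ (2/3)yT and E ≤ T coincide; each is used where it is the
    -- sharper.
    rcases le_total y (3 / 2) with h | h
    · have h2 : E * T ≤ 2 / 3 * y * T * T := by gcongr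
      have h3 : E ^ 2 ≤ (2 / 3 * y * T) ^ 2 := by gcongr
      have h4 : 4 * y * (1 + y) * (E * T) ≤ 4 * y * (1 + y) * (2 / 3 * y * T * T) := by gcongr
      have h5 : (1 + y) ^ 2 * E ^ 2 ≤ (1 + y) ^ 2 * (2 / 3 * y * T) ^ 2 := by gcongr
      have h6 : 0 ≤ 7 / 2 + (8 - 8 / 3 - 4 / 9 - 1 / 2) * y - (8 / 3 + 8 / 9) * y ^ 2 -
          4 / 9 * y ^ 3 := by
        have : 0 ≤ y * (3 / 2 - y) := mul_nonneg hy0.le (by linarith)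
        have : 0 ≤ y * (y * (3 / 2 - y)) := mul_nonneg hy0.le this
        nlinarith
      have h7 := mul_nonneg (mul_nonneg hy0.le (sq_nonneg T)) h6
      linarith
    · have h2 : E * T ≤ T * T := by gcongr
      have h3 : E ^ 2 ≤ T ^ 2 := by gcongr
      have h4 : 4 * y * (1 + y) * (E * T) ≤ 4 * y * (1 + y) * (T * T) := by gcongr
      have h5 : (1 + y) ^ 2 * E ^ 2 ≤ (1 + y) ^ 2 * T ^ 2 := by gcongr
      have h6 : 0 ≤ 5 / 2 * y ^ 2 - 5 / 2 * y - 1 := by nlinarith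
      have h7 := mul_nonneg (sq_nonneg T) h6
      linarith
  calc _ = 1 / 2 * Real.tanh r ^ 2 * (r ^ 2 * (1 + r ^ 2)) * (1 + r ^ 2) := by ring
    _ ≤ _ := by gcongr

end FDKP

/-! ### Contour deformation for the angular integral. -/

namespace FDKP

open Set MeasureTheory intervalIntegral

theorem intervalIntegral_swap_of_continuous {F : ℝ → ℝ → ℂ} (hF : Continuous F.uncurry)
    (a b c d : ℝ) : ∫ x in a..b, ∫ y in c..d, F x y = ∫ y in c..d, ∫ x in a..b, F x y := by
  apply intervalIntegral_intervalIntegral_swap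
  exact (hF.continuousOn.integrableOn_compact
    ((isCompact_uIcc (a := a) (b := b)).prod (isCompact_uIcc (a := c) (b := d)))).mono_set
    (prod_mono uIoc_subset_uIcc uIoc_subset_uIcc)

/-- The holomorphic extension of `1 / cos ψ` as a function of `z = sin ψ`. -/
noncomputable def arcsinDeriv (z : ℂ) : ℂ := (1 - z ^ 2) ^ ((-1 / 2 : ℝ) : ℂ)

theorem one_sub_sq_mem_slitPlane {z : ℂ} (hz : |z.re| < 1 ∨ z.im ≠ 0) :
    1 - z ^ 2 ∈ Complex.slitPlane := by
  rw [Complex.mem_slitPlane_iff]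
  have hre : (1 - z ^ 2).re = 1 - z.re ^ 2 + z.im ^ 2 := by
    simp [sq]; ring
  have him : (1 - z ^ 2).im = -2 * (z.re * z.im) := by
    simp [sq]; ring
  rw [hre, him]
  rcases hz with h | h
  · left
    have : z.re ^ 2 < 1 := (sq_lt_one_iff_abs_lt_one _).2 h
    positivity
  · by_cases h0 : z.re = 0
    · left
      rw [h0]
      positivity
    · right
      simp [h0, h]

theorem differentiableAt_arcsinDeriv {z : ℂ} (hz : |z.re| < 1 ∨ z.im ≠ 0) :
    DifferentiableAt ℂ arcsinDeriv z :=
  DifferentiableAt.cpow (by fun_prop) (by fun_prop) (one_sub_sq_mem_slitPlane hz)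

/-- Factor 1 - z² = (1 - z)(1 + z): the first factor is at least Im z in modulus and the second at
least 1. The bound is uniform in Re z ≥ 0, hence survives as the foot of the ray approaches the
branch point 1. -/
theorem norm_arcsinDeriv_le {z : ℂ} (hre : 0 ≤ z.re) (him : 0 < z.im) :
    ‖arcsinDeriv z‖ ≤ z.im ^ (-1 / 2 : ℝ) := by
  rw [arcsinDeriv, Complex.norm_cpow_real]
  apply Real.rpow_le_rpow_of_nonpos him _ (by norm_num)
  have h1 : z.im ≤ ‖1 - z‖ := by
    have := Complex.abs_im_le_norm (1 - z)
    simp only [Complex.sub_im, Complex.one_im, zero_sub, abs_neg] at this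
    exact (le_abs_self _).trans this
  have h2 : 1 ≤ ‖1 + z‖ := by
    have := Complex.re_le_norm (1 + z)
    simp only [Complex.add_re, Complex.one_re] at this
    linarith
  calc z.im = z.im * 1 := (mul_one _).symm
    _ ≤ ‖1 - z‖ * ‖1 + z‖ := by gcongr
    _ = ‖1 - z ^ 2‖ := by rw [← norm_mul]; ring_nf

theorem arcsinDeriv_sin {ψ : ℝ} (h : 0 < Real.cos ψ) :
    arcsinDeriv (Real.sin ψ : ℝ) = ((Real.cos ψ)⁻¹ : ℝ) := by
  have h1 : (1 - ((Real.sin ψ : ℝ) : ℂ) ^ 2) = ((Real.cos ψ ^ 2 : ℝ) : ℂ) := by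
    rw [← Complex.ofReal_pow, ← Complex.ofReal_one, ← Complex.ofReal_sub]
    congr 1
    linarith [Real.sin_sq_add_cos_sq ψ]
  rw [arcsinDeriv, h1, ← Complex.ofReal_cpow (by positivity), ← Real.rpow_natCast,
    ← Real.rpow_mul h.le]
  norm_num [Real.rpow_neg_one]

theorem continuous_arcsinDeriv_vertical {k : ℝ} (hk : |k| < 1) :
    Continuous fun y : ℝ => arcsinDeriv (k + y * Complex.I) :=
  continuous_iff_continuousAt.2 fun y =>
    (ContinuousAt.comp (g := arcsinDeriv) (f := fun y : ℝ => (k + y * Complex.I : ℂ))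
      (differentiableAt_arcsinDeriv (Or.inl (by simpa using hk))).continuousAt
      (by fun_prop : Continuous fun y : ℝ => (k + y * Complex.I : ℂ)).continuousAt)

theorem continuous_arcsinDeriv_horizontal {Y : ℝ} (hY : Y ≠ 0) :
    Continuous fun x : ℝ => arcsinDeriv (x + Y * Complex.I) :=
  continuous_iff_continuousAt.2 fun y =>
    (ContinuousAt.comp (g := arcsinDeriv) (f := fun x : ℝ => (x + Y * Complex.I : ℂ))
      (differentiableAt_arcsinDeriv (Or.inr (by simpa using hY))).continuousAt
      (by fun_prop : Continuous fun x : ℝ => (x + Y * Complex.I : ℂ)).continuousAt)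

/-- Contour deformation for `∫₀ᵏ e^{isz} (1 - z²)^{-1/2} dz`. -/
theorem integral_exp_mul_arcsinDeriv {s k Y : ℝ} (hk0 : 0 ≤ k) (hk1 : k < 1) :
    ∫ x in (0 : ℝ)..k, Complex.exp (Complex.I * (s * x)) * arcsinDeriv x =
      (∫ x in (0 : ℝ)..k, Complex.exp (Complex.I * (s * (x + Y * Complex.I))) *
          arcsinDeriv (x + Y * Complex.I)) -
        Complex.I * (∫ y in (0 : ℝ)..Y,
          Complex.exp (Complex.I * (s * (k + y * Complex.I))) *
            arcsinDeriv (k + y * Complex.I)) +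
        Complex.I * (∫ y in (0 : ℝ)..Y,
          Complex.exp (Complex.I * (s * ((0 : ℝ) + y * Complex.I))) *
            arcsinDeriv ((0 : ℝ) + y * Complex.I)) := by
  set h : ℂ → ℂ := fun z => Complex.exp (Complex.I * (s * z)) * arcsinDeriv z with hh
  have hrect := Complex.integral_boundary_rect_eq_zero_of_differentiableOn h 0
    (k + Y * Complex.I) (fun z hz => by
      rw [Complex.mem_reProdIm] at hz
      have h1 := hz.1
      simp only [Complex.zero_re, Complex.add_re, Complex.ofReal_re, Complex.mul_re, Complex.I_re,
        mul_zero, Complex.ofReal_im, Complex.I_im, mul_one, sub_self, add_zero,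
        uIcc_of_le hk0] at h1
      have := differentiableAt_arcsinDeriv (z := z)
        (Or.inl (by rw [abs_of_nonneg h1.1]; linarith [h1.2]))
      simp only [hh]
      exact DifferentiableAt.differentiableWithinAt (by fun_prop))
  simp at hrect
  simp only [hh] at hrect ⊢
  simp
  linear_combination hrect

/-- Substitution x = sin ψ. The strict bound on c keeps x away from the branch point. -/
theorem integral_exp_sin_eq {s c : ℝ} (hc : 0 ≤ c) (hc' : c < Real.pi / 2) :
    ∫ ψ in (0 : ℝ)..c, Complex.exp (Complex.I * ((s * Real.sin ψ : ℝ) : ℂ)) =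
      ∫ x in (0 : ℝ)..Real.sin c, Complex.exp (Complex.I * (s * x)) * arcsinDeriv x := by
  set h : ℂ → ℂ := fun z => Complex.exp (Complex.I * (s * z)) * arcsinDeriv z with hh
  have hcv := integral_deriv_smul_comp' (a := 0) (b := c) (f := Real.sin) (f' := Real.cos)
    (g := fun x : ℝ => h x) (fun x _ => Real.hasDerivAt_sin x) Real.continuous_cos.continuousOn
    (by
      rintro _ ⟨ψ, hψ, rfl⟩
      rw [uIcc_of_le hc] at hψ
      have h0 : 0 ≤ Real.sin ψ := Real.sin_nonneg_of_nonneg_of_le_pi hψ.1 (by linarith [hψ.2])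
      have h1 : Real.sin ψ < 1 := by
        rw [← Real.sin_pi_div_two]
        exact Real.sin_lt_sin_of_lt_of_le_pi_div_two (by linarith [hψ.1]) le_rfl
          (by linarith [hψ.2])
      have := differentiableAt_arcsinDeriv (z := (Real.sin ψ : ℝ)) (Or.inl (by
        rw [Complex.ofReal_re, abs_of_nonneg h0]; exact h1))
      have hd : DifferentiableAt ℂ h (Real.sin ψ : ℝ) := by
        simp only [hh]
        fun_prop
      exact (ContinuousAt.comp (g := h) (f := fun x : ℝ => (x : ℂ)) hd.continuousAt
        Complex.continuous_ofReal.continuousAt).continuousWithinAt)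
  rw [Real.sin_zero] at hcv
  simp only [hh] at hcv
  rw [← hcv]
  apply integral_congr
  intro ψ hψ
  rw [uIcc_of_le hc] at hψ
  have hcos : 0 < Real.cos ψ := Real.cos_pos_of_mem_Ioo ⟨by linarith [hψ.1, Real.pi_pos],
    by linarith [hψ.2]⟩
  have hne : ((Real.cos ψ : ℝ) : ℂ) ≠ 0 := by exact_mod_cast hcos.ne'
  simp only [Function.comp_apply]
  rw [arcsinDeriv_sin hcos, Complex.real_smul, Complex.ofReal_inv, Complex.ofReal_mul]
  rw [mul_comm ((Real.cos ψ : ℝ) : ℂ), mul_assoc, inv_mul_cancel₀ hne, mul_one]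

end FDKP

/-! ### Radial integrals with a dyadic phase. -/

namespace FDKP

open Set MeasureTheory intervalIntegral

/-- A continuous phase function on the dyadic interval `[Λ/2, 2Λ]`, with first derivative at least
`μ` and second derivative of constant sign and modulus at least `l²`. -/
structure IsDyadicPhase (m m₁ m₂ : ℝ → ℝ) (Λ μ l : ℝ) : Prop where
  pos : 0 < Λ
  slope_pos : 0 < μ
  curv_pos : 0 < l
  cont : Continuous m
  deriv : ∀ r ∈ Icc (Λ / 2) (2 * Λ), HasDerivAt m (m₁ r) r
  deriv2 : ∀ r ∈ Icc (Λ / 2) (2 * Λ), HasDerivAt m₁ (m₂ r) r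
  cont2 : ContinuousOn m₂ (Icc (Λ / 2) (2 * Λ))
  slope : ∀ r ∈ Icc (Λ / 2) (2 * Λ), μ ≤ m₁ r
  curv : (∀ r ∈ Icc (Λ / 2) (2 * Λ), l ^ 2 ≤ m₂ r) ∨ ∀ r ∈ Icc (Λ / 2) (2 * Λ), l ^ 2 ≤ -m₂ r

namespace IsDyadicPhase

variable {m m₁ m₂ : ℝ → ℝ} {Λ μ l : ℝ}

/-- Up to a sign, the phase `A r + t m(r)` is convex with a quantitative bound. -/
theorem exists_convex_phase (H : IsDyadicPhase m m₁ m₂ Λ μ l) {t : ℝ} (A : ℝ) (ht : t ≠ 0) :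
    ∃ σ : ℝ, (σ = 1 ∨ σ = -1) ∧ ∀ r ∈ Icc (Λ / 2) (2 * Λ), |t| * l ^ 2 ≤ σ * t * m₂ r ∧
      HasDerivAt (fun r => σ * (A * r + t * m r)) (σ * (A + t * m₁ r)) r ∧
      HasDerivAt (fun r => σ * (A + t * m₁ r)) (σ * t * m₂ r) r := by
  have hd : ∀ σ : ℝ, ∀ r ∈ Icc (Λ / 2) (2 * Λ),
      HasDerivAt (fun r => σ * (A * r + t * m r)) (σ * (A + t * m₁ r)) r ∧
      HasDerivAt (fun r => σ * (A + t * m₁ r)) (σ * t * m₂ r) r := fun σ r hr => by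
    constructor
    · have := ((((hasDerivAt_id r).const_mul A).add ((H.deriv r hr).const_mul t)).const_mul σ)
      exact this.congr_deriv (by ring)
    · have := (((H.deriv2 r hr).const_mul t).const_add A).const_mul σ
      exact this.congr_deriv (by ring)
  rcases H.curv with hc | hc <;> rcases ht.lt_or_gt with h | h
  · refine ⟨-1, Or.inr rfl, fun r hr => ⟨?_, hd _ r hr⟩⟩
    rw [abs_of_neg h]
    nlinarith [hc r hr]
  · refine ⟨1, Or.inl rfl, fun r hr => ⟨?_, hd _ r hr⟩⟩
    rw [abs_of_pos h]
    nlinarith [hc r hr]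
  · refine ⟨1, Or.inl rfl, fun r hr => ⟨?_, hd _ r hr⟩⟩
    rw [abs_of_neg h]
    nlinarith [hc r hr]
  · refine ⟨-1, Or.inr rfl, fun r hr => ⟨?_, hd _ r hr⟩⟩
    rw [abs_of_pos h]
    nlinarith [hc r hr]

theorem norm_integral_sign {σ : ℝ} (hσ : σ = 1 ∨ σ = -1) (φ : ℝ → ℝ) (a b : ℝ) :
    ‖∫ r in a..b, Complex.exp (Complex.I * ((σ * φ r : ℝ) : ℂ))‖ =
      ‖∫ r in a..b, Complex.exp (Complex.I * (φ r : ℂ))‖ := by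
  rcases hσ with rfl | rfl
  · simp only [one_mul]
  · simp only [neg_one_mul]
    exact norm_integral_cexp_neg φ a b

/-- The linear term cancels at most half of t m', leaving a phase derivative of modulus at least
|t|μ/2. -/
theorem norm_integral_le_of_slope (H : IsDyadicPhase m m₁ m₂ Λ μ l) {t A : ℝ} (ht : t ≠ 0)
    (hA : |A| ≤ |t| * μ / 2) {b : ℝ} (hb : b ∈ Icc (Λ / 2) (2 * Λ)) :
    ‖∫ r in (Λ / 2)..b, Complex.exp (Complex.I * ((A * r + t * m r : ℝ) : ℂ))‖ ≤
      8 / (|t| * μ) := by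
  obtain ⟨σ, hσ, h⟩ := H.exists_convex_phase A ht
  have hs : Icc (Λ / 2) b ⊆ Icc (Λ / 2) (2 * Λ) := Icc_subset_Icc_right hb.2
  have ht0 := abs_pos.2 ht
  have hμ := H.slope_pos
  rw [← norm_integral_sign hσ]
  have := norm_integral_cexp_le_of_le_abs_deriv hb.1 (by positivity : 0 < |t| * μ / 2)
    (fun r hr => (h r (hs hr)).2.1) (fun r hr => (h r (hs hr)).2.2)
    ((H.cont2.mono hs).const_smul (σ * t))
    (fun r hr => le_trans (by positivity) (h r (hs hr)).1)
    (fun r hr => by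
      have hσ1 : |σ| = 1 := by rcases hσ with rfl | rfl <;> simp
      rw [abs_mul, hσ1, one_mul]
      have h1 : |t| * μ ≤ |t * m₁ r| := by
        rw [abs_mul]
        gcongr
        exact (H.slope r (hs hr)).trans (le_abs_self _)
      have h2 := abs_sub_abs_le_abs_add (t * m₁ r) A
      rw [add_comm] at h2
      linarith)
  refine this.trans (le_of_eq ?_)
  field_simp
  norm_num

/-- A linear term does not change the second derivative, so the bound is uniform in A. -/
theorem norm_integral_le_of_curv (H : IsDyadicPhase m m₁ m₂ Λ μ l) {t : ℝ} (A : ℝ) (ht : t ≠ 0)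
    {b : ℝ} (hb : b ∈ Icc (Λ / 2) (2 * Λ)) :
    ‖∫ r in (Λ / 2)..b, Complex.exp (Complex.I * ((A * r + t * m r : ℝ) : ℂ))‖ ≤
      10 / (√|t| * l) := by
  obtain ⟨σ, hσ, h⟩ := H.exists_convex_phase A ht
  have hs : Icc (Λ / 2) b ⊆ Icc (Λ / 2) (2 * Λ) := Icc_subset_Icc_right hb.2
  have ht0 := abs_pos.2 ht
  have hl := H.curv_pos
  rw [← norm_integral_sign hσ]
  exact norm_integral_cexp_le_of_le_deriv2 hb.1 (by positivity)
    (fun r hr => (h r (hs hr)).2.1) (fun r hr => (h r (hs hr)).2.2)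
    ((H.cont2.mono hs).const_smul (σ * t))
    (fun r hr => by
      rw [mul_pow, Real.sq_sqrt ht0.le]
      exact (h r (hs hr)).1)

/-- The damping exp(-κr) comes from the shifted contour. Half of its decay absorbs the factor |1 -
κr| ≤ 2exp(κr/2) in the amplitude's derivative; the other half, at r ≥ Λ/2, leaves exp(-κΛ/4). -/
theorem norm_integral_amplitude_le (H : IsDyadicPhase m m₁ m₂ Λ μ l) {t A κ C : ℝ} (hκ : 0 ≤ κ)
    (hC : ∀ b ∈ Icc (Λ / 2) (2 * Λ),
      ‖∫ r in (Λ / 2)..b, Complex.exp (Complex.I * ((A * r + t * m r : ℝ) : ℂ))‖ ≤ C) :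
    ‖∫ r in (Λ / 2)..(2 * Λ), ((r * Real.exp (-(κ * r)) : ℝ) : ℂ) *
      Complex.exp (Complex.I * ((A * r + t * m r : ℝ) : ℂ))‖ ≤
      5 * Λ * Real.exp (-(κ * Λ / 4)) * C := by
  have hΛ := H.pos
  have hm := H.cont
  have := norm_integral_mul_le_of_primitive_bound
    (e := fun r => Complex.exp (Complex.I * ((A * r + t * m r : ℝ) : ℂ)))
    (ψ := fun r => r * Real.exp (-(κ * r)))
    (ψ₁ := fun r => (1 - κ * r) * Real.exp (-(κ * r)))
    (A := 2 * Λ * Real.exp (-(κ * Λ / 4))) (B := 2 * Real.exp (-(κ * Λ / 4)))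
    (by linarith : Λ / 2 ≤ 2 * Λ) (by fun_prop) hC
    (fun r _ => by
      have := (hasDerivAt_id r).mul (((hasDerivAt_id r).const_mul κ).neg.exp)
      exact this.congr_deriv (by simp; ring))
    (by fun_prop)
    (by
      rw [abs_of_nonneg (by positivity)]
      gcongr
      nlinarith [mul_nonneg hκ hΛ.le])
    (fun r hr => by
      have hr0 : 0 < r := by linarith [hr.1]
      have hu : 0 ≤ κ * r := by positivity
      have h1 : |1 - κ * r| ≤ 2 * Real.exp (κ * r / 2) := by
        have := Real.add_one_le_exp (κ * r / 2)
        rw [abs_le]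
        constructor <;> linarith
      rw [abs_mul, abs_of_pos (Real.exp_pos _)]
      calc _ ≤ 2 * Real.exp (κ * r / 2) * Real.exp (-(κ * r)) := by gcongr
        _ = 2 * Real.exp (-(κ * r / 2)) := by
            rw [mul_assoc, ← Real.exp_add]; ring_nf
        _ ≤ _ := by
            gcongr 2 * Real.exp (-?_)
            nlinarith [mul_le_mul_of_nonneg_left hr.1 hκ])
  refine this.trans (le_of_eq ?_)
  ring

end IsDyadicPhase

/-- The radial integral with angular variable `ψ`. -/
noncomputable def radialIntegral (m : ℝ → ℝ) (Λ R t ψ : ℝ) : ℂ :=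
  ∫ r in (Λ / 2)..(2 * Λ),
    (r : ℂ) * Complex.exp (Complex.I * ((R * Real.sin ψ * r + t * m r : ℝ) : ℂ))

theorem continuous_radialIntegral {m : ℝ → ℝ} (hm : Continuous m) (Λ R t : ℝ) :
    Continuous (radialIntegral m Λ R t) := by
  unfold radialIntegral
  apply continuous_parametric_intervalIntegral_of_continuous'
  fun_prop

theorem radialIntegral_pi_sub (m : ℝ → ℝ) (Λ R t ψ : ℝ) :
    radialIntegral m Λ R t (Real.pi - ψ) = radialIntegral m Λ R t ψ := by
  simp only [radialIntegral, Real.sin_pi_sub]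

theorem radialIntegral_neg (m : ℝ → ℝ) (Λ R t ψ : ℝ) :
    radialIntegral m Λ R t (-ψ) = radialIntegral m Λ (-R) t ψ := by
  simp only [radialIntegral, Real.sin_neg, mul_neg, neg_mul]

theorem radialIntegral_sub_pi (m : ℝ → ℝ) (Λ R t ψ : ℝ) :
    radialIntegral m Λ R t (ψ - Real.pi) = radialIntegral m Λ (-R) t ψ := by
  simp only [radialIntegral, Real.sin_sub_pi, mul_neg, neg_mul]

theorem radialIntegral_conj (m : ℝ → ℝ) (Λ R t ψ : ℝ) :
    radialIntegral m Λ (-R) (-t) ψ = starRingEnd ℂ (radialIntegral m Λ R t ψ) := by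
  rw [radialIntegral, radialIntegral, ← intervalIntegral_conj]
  apply integral_congr
  intro r _
  simp only [map_mul, ← Complex.exp_conj, Complex.conj_ofReal, Complex.conj_I]
  push_cast
  ring_nf

/-- Half-line integral of `y^{-1/2} e^{-κ y}`. -/
theorem integral_rpow_mul_exp_le {κ Y : ℝ} (hκ : 0 < κ) (hY : 0 ≤ Y) :
    IntervalIntegrable (fun y : ℝ => y ^ (-1 / 2 : ℝ) * Real.exp (-(κ * y))) volume 0 Y ∧
    ∫ y in (0 : ℝ)..Y, y ^ (-1 / 2 : ℝ) * Real.exp (-(κ * y)) ≤ 2 / √κ := by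
  have hint : IntegrableOn (fun y : ℝ => y ^ (-1 / 2 : ℝ) * Real.exp (-(κ * y))) (Ioi 0) := by
    have := integrableOn_rpow_mul_exp_neg_mul_rpow (s := -1 / 2) (p := 1) (b := κ) (by norm_num)
      one_pos hκ
    simpa [neg_mul] using this
  refine ⟨(intervalIntegrable_iff_integrableOn_Ioc_of_le hY).2
    (hint.mono_set Ioc_subset_Ioi_self), ?_⟩
  have hval := Real.integral_rpow_mul_exp_neg_mul_Ioi (a := 1 / 2) (r := κ) (by norm_num) hκ
  rw [Real.Gamma_one_half_eq, ← Real.sqrt_eq_rpow, show (1 / 2 - 1 : ℝ) = -1 / 2 by norm_num]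
    at hval
  rw [integral_of_le hY]
  calc _ ≤ ∫ y in Ioi (0 : ℝ), y ^ (-1 / 2 : ℝ) * Real.exp (-(κ * y)) := by
        apply setIntegral_mono_set hint
        · filter_upwards [ae_restrict_mem measurableSet_Ioi] with y hy
          have : (0 : ℝ) < y := hy
          simp only [Pi.zero_apply]
          positivity
        · exact LE.le.eventuallyLE (Ioc_subset_Ioi_self (b := (0 : ℝ)) (a := Y))
    _ = √(1 / κ) * √Real.pi := hval
    _ ≤ √(1 / κ) * 2 := by
        gcongr
        rw [Real.sqrt_le_left (by norm_num)]
        linarith [Real.pi_le_four]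
    _ = 2 / √κ := by rw [Real.sqrt_div zero_le_one, Real.sqrt_one]; ring

end FDKP

/-! ### Decay of the integral over circular arcs. -/

namespace FDKP

open Set MeasureTheory intervalIntegral

namespace IsDyadicPhase

variable {m m₁ m₂ : ℝ → ℝ} {Λ μ l : ℝ}

theorem norm_radialIntegral_le (H : IsDyadicPhase m m₁ m₂ Λ μ l) {t R : ℝ} (ht : t ≠ 0)
    (hR : |R| ≤ |t| * μ / 2) (ψ : ℝ) :
    ‖radialIntegral m Λ R t ψ‖ ≤ 40 * (Λ / μ) / |t| := by
  have hA : |R * Real.sin ψ| ≤ |t| * μ / 2 := by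
    rw [abs_mul]
    calc |R| * |Real.sin ψ| ≤ |R| * 1 := by gcongr; exact Real.abs_sin_le_one ψ
      _ ≤ _ := by linarith
  have := H.norm_integral_amplitude_le (κ := 0) le_rfl
    (fun b hb => H.norm_integral_le_of_slope ht hA hb)
  simp only [zero_mul, neg_zero, Real.exp_zero, mul_one, zero_div] at this
  refine this.trans (le_of_eq ?_)
  have := H.slope_pos
  field_simp
  ring

/-- Integrate in r first. At height y the phase is Rkr + t m(r) with damping exp(-Rry), so curvature
gives |t|^{-1/2} exp(-RΛy/4). Integrating this against y^{-1/2} gives (RΛ)^{-1/2}, which the lower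
bound on R converts into the second |t|^{-1/2}. -/
theorem norm_vertical_le (H : IsDyadicPhase m m₁ m₂ Λ μ l) {t R k Y : ℝ} (ht : t ≠ 0)
    (hR : |t| * μ / 2 ≤ R) (hk0 : 0 ≤ k) (hk1 : k < 1) (hY : 0 ≤ Y) :
    ‖∫ r in (Λ / 2)..(2 * Λ), (r * Complex.exp (Complex.I * ((t * m r : ℝ) : ℂ))) *
      ∫ y in (0 : ℝ)..Y, Complex.exp (Complex.I * (((R * r : ℝ) : ℂ) * (k + y * Complex.I))) *
        arcsinDeriv (k + y * Complex.I)‖ ≤ 300 * (Λ / (l * √(μ * Λ))) / |t| := by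
  have hΛ := H.pos
  have hμ := H.slope_pos
  have hl := H.curv_pos
  have hm := H.cont
  have ht0 := abs_pos.2 ht
  have hR0 : 0 < R := lt_of_lt_of_le (by positivity) hR
  have ha := continuous_arcsinDeriv_vertical (k := k) (by rwa [abs_of_nonneg hk0])
  have hswap : ∫ r in (Λ / 2)..(2 * Λ), (r * Complex.exp (Complex.I * ((t * m r : ℝ) : ℂ))) *
      ∫ y in (0 : ℝ)..Y, Complex.exp (Complex.I * (((R * r : ℝ) : ℂ) * (k + y * Complex.I))) *
        arcsinDeriv (k + y * Complex.I) =
      ∫ y in (0 : ℝ)..Y, arcsinDeriv (k + y * Complex.I) *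
        ∫ r in (Λ / 2)..(2 * Λ), ((r * Real.exp (-((R * y) * r)) : ℝ) : ℂ) *
          Complex.exp (Complex.I * (((R * k) * r + t * m r : ℝ) : ℂ)) := by
    simp_rw [← intervalIntegral.integral_const_mul]
    rw [intervalIntegral_swap_of_continuous]
    · apply integral_congr
      intro y _
      apply integral_congr
      intro r _
      simp only [Complex.ofReal_mul, Complex.ofReal_exp]
      have : Complex.exp (Complex.I * (t * m r)) *
          Complex.exp (Complex.I * (R * r * (k + y * Complex.I))) =
          Complex.exp (((-(R * y * r) : ℝ)) : ℂ) *
            Complex.exp (Complex.I * ((R * k * r + t * m r : ℝ) : ℂ)) := by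
        rw [← Complex.exp_add, ← Complex.exp_add]
        congr 1
        push_cast
        linear_combination (R * r * y : ℂ) * Complex.I_mul_I
      linear_combination (r * arcsinDeriv (k + y * Complex.I) : ℂ) * this
    · have ha' : Continuous fun p : ℝ × ℝ => arcsinDeriv (k + p.2 * Complex.I) :=
        ha.comp continuous_snd
      simp only [Function.uncurry_def]
      fun_prop
  rw [hswap]
  obtain ⟨hint, hle⟩ := integral_rpow_mul_exp_le (κ := R * Λ / 4) (by positivity) hY
  -- The hypothesis gives the denominator 8; weakening it to 9 makes the square root rational.
  have hκ : |t| * (μ * Λ) / 9 ≤ R * Λ / 4 := by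
    nlinarith [mul_le_mul_of_nonneg_right hR hΛ.le, mul_pos ht0 (mul_pos hμ hΛ)]
  have hsqrt : √|t| * √(μ * Λ) / 3 ≤ √(R * Λ / 4) := by
    apply Real.le_sqrt_of_sq_le
    rw [div_pow, mul_pow, Real.sq_sqrt ht0.le, Real.sq_sqrt (by positivity)]
    norm_num
    exact hκ
  calc _ ≤ ∫ y in (0 : ℝ)..Y, (5 * Λ * (10 / (√|t| * l))) *
          (y ^ (-1 / 2 : ℝ) * Real.exp (-(R * Λ / 4 * y))) := by
        apply norm_integral_le_of_norm_le hY _ (hint.const_mul _)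
        refine Filter.Eventually.of_forall fun y hy => ?_
        have hy0 : 0 < y := hy.1
        rw [norm_mul]
        have h1 := norm_arcsinDeriv_le (z := k + y * Complex.I) (by simpa using hk0)
          (by simpa using hy0)
        have h2 := H.norm_integral_amplitude_le (A := R * k) (κ := R * y) (by positivity)
          (fun b hb => H.norm_integral_le_of_curv (R * k) ht hb)
        rw [show (k + y * Complex.I : ℂ).im = y by simp] at h1
        calc _ ≤ y ^ (-1 / 2 : ℝ) * (5 * Λ * Real.exp (-(R * y * Λ / 4)) * (10 / (√|t| * l))) :=
              mul_le_mul h1 h2 (norm_nonneg _) (by positivity)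
          _ = _ := by
              rw [show R * y * Λ / 4 = R * Λ / 4 * y by ring]
              ring
    _ ≤ (5 * Λ * (10 / (√|t| * l))) * (2 / √(R * Λ / 4)) := by
        rw [intervalIntegral.integral_const_mul]
        gcongr
    _ ≤ (5 * Λ * (10 / (√|t| * l))) * (2 / (√|t| * √(μ * Λ) / 3)) := by gcongr
    _ = 300 * (Λ / (l * √(μ * Λ))) / (√|t| * √|t|) := by
        have : 0 < √(μ * Λ) := by positivity
        have : 0 < √|t| := by positivity
        field_simp
        norm_num
    _ = _ := by rw [Real.mul_self_sqrt ht0.le]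

/-- The top side of the rectangle needs no oscillation: the weight alone makes it vanish as Y → ∞.
-/
theorem norm_horizontal_le (H : IsDyadicPhase m m₁ m₂ Λ μ l) {t R k Y : ℝ} (hR : 0 ≤ R)
    (hk0 : 0 ≤ k) (hk1 : k < 1) (hY : 0 < Y) :
    ‖∫ r in (Λ / 2)..(2 * Λ), (r * Complex.exp (Complex.I * ((t * m r : ℝ) : ℂ))) *
      ∫ x in (0 : ℝ)..k, Complex.exp (Complex.I * (((R * r : ℝ) : ℂ) * (x + Y * Complex.I))) *
        arcsinDeriv (x + Y * Complex.I)‖ ≤ 3 * Λ ^ 2 * Y ^ (-1 / 2 : ℝ) := by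
  have hΛ := H.pos
  have := intervalIntegral.norm_integral_le_of_norm_le_const (a := Λ / 2) (b := 2 * Λ)
    (C := 2 * Λ * Y ^ (-1 / 2 : ℝ))
    (f := fun r => (r * Complex.exp (Complex.I * ((t * m r : ℝ) : ℂ))) *
      ∫ x in (0 : ℝ)..k, Complex.exp (Complex.I * (((R * r : ℝ) : ℂ) * (x + Y * Complex.I))) *
        arcsinDeriv (x + Y * Complex.I)) (fun r hr => ?_)
  · refine this.trans (le_of_eq ?_)
    rw [abs_of_pos (by linarith)]
    ring
  · rw [uIoc_of_le (by linarith)] at hr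
    have hr0 : 0 < r := by linarith [hr.1]
    rw [norm_mul, norm_mul, Complex.norm_exp_I_mul_ofReal, mul_one, Complex.norm_real,
      Real.norm_eq_abs, abs_of_pos hr0]
    have h1 := intervalIntegral.norm_integral_le_of_norm_le_const (a := 0) (b := k)
      (C := Y ^ (-1 / 2 : ℝ))
      (f := fun x : ℝ => Complex.exp (Complex.I * (((R * r : ℝ) : ℂ) * (x + Y * Complex.I))) *
        arcsinDeriv (x + Y * Complex.I)) (fun x hx => by
          rw [uIoc_of_le hk0] at hx
          have h2 := norm_arcsinDeriv_le (z := x + Y * Complex.I) (by simpa using hx.1.le)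
            (by simpa using hY)
          rw [show (x + Y * Complex.I : ℂ).im = Y by simp] at h2
          have h3 : ‖Complex.exp (Complex.I * (((R * r : ℝ) : ℂ) * (x + Y * Complex.I)))‖ ≤ 1 := by
            rw [Complex.norm_exp, Real.exp_le_one_iff]
            simp
            positivity
          rw [norm_mul]
          calc _ ≤ 1 * Y ^ (-1 / 2 : ℝ) := mul_le_mul h3 h2 (norm_nonneg _) zero_le_one
            _ = _ := one_mul _)
    rw [sub_zero, abs_of_nonneg hk0] at h1
    apply mul_le_mul hr.2 _ (norm_nonneg _) (by linarith)
    refine h1.trans ?_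
    exact mul_le_of_le_one_right (by positivity) hk1.le

theorem norm_integral_arc_le_of_large (H : IsDyadicPhase m m₁ m₂ Λ μ l) {t R c : ℝ} (ht : t ≠ 0)
    (hR : |t| * μ / 2 ≤ R) (hc : 0 ≤ c) (hc' : c < Real.pi / 2) :
    ‖∫ ψ in (0 : ℝ)..c, radialIntegral m Λ R t ψ‖ ≤ 600 * (Λ / (l * √(μ * Λ))) / |t| := by
  have hm := H.cont
  have hμ := H.slope_pos
  have hR0 : 0 ≤ R := le_trans (by positivity) hR
  have hk0 : 0 ≤ Real.sin c := Real.sin_nonneg_of_nonneg_of_le_pi hc (by linarith)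
  have hk1 : Real.sin c < 1 := by
    rw [← Real.sin_pi_div_two]
    exact Real.sin_lt_sin_of_lt_of_le_pi_div_two (by linarith) le_rfl hc'
  have hswap : ∫ ψ in (0 : ℝ)..c, radialIntegral m Λ R t ψ =
      ∫ r in (Λ / 2)..(2 * Λ), (r * Complex.exp (Complex.I * ((t * m r : ℝ) : ℂ))) *
        ∫ x in (0 : ℝ)..Real.sin c, Complex.exp (Complex.I * (((R * r : ℝ) : ℂ) * x)) *
          arcsinDeriv x := by
    simp only [radialIntegral]
    rw [intervalIntegral_swap_of_continuous]
    · apply integral_congr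
      intro r _
      simp only
      rw [← integral_exp_sin_eq hc hc', ← intervalIntegral.integral_const_mul]
      apply integral_congr
      intro ψ _
      simp only
      rw [mul_assoc (r : ℂ), ← Complex.exp_add]
      congr 2
      push_cast
      ring
    · simp only [Function.uncurry_def]
      fun_prop
  -- Cauchy's theorem on a rectangle of finite height Y: the vertical sides at 0 and at sin c cost
  -- 300 each, uniformly in Y.
  have key : ∀ Y : ℝ, 0 < Y → ‖∫ ψ in (0 : ℝ)..c, radialIntegral m Λ R t ψ‖ ≤
      3 * Λ ^ 2 * Y ^ (-1 / 2 : ℝ) + 600 * (Λ / (l * √(μ * Λ))) / |t| := fun Y hY => by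
    have hvert : ∀ k : ℝ, |k| < 1 → Continuous fun r : ℝ =>
        (r * Complex.exp (Complex.I * ((t * m r : ℝ) : ℂ))) *
        ∫ y in (0 : ℝ)..Y, Complex.exp (Complex.I * (((R * r : ℝ) : ℂ) * (k + y * Complex.I))) *
          arcsinDeriv (k + y * Complex.I) := fun k hk => by
      have ha' : Continuous fun p : ℝ × ℝ => arcsinDeriv (k + p.2 * Complex.I) :=
        (continuous_arcsinDeriv_vertical hk).comp continuous_snd
      apply Continuous.mul (by fun_prop)
      apply continuous_parametric_intervalIntegral_of_continuous'
      simp only [Function.uncurry_def]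
      fun_prop
    have hhor : Continuous fun r : ℝ =>
        (r * Complex.exp (Complex.I * ((t * m r : ℝ) : ℂ))) *
        ∫ x in (0 : ℝ)..Real.sin c,
          Complex.exp (Complex.I * (((R * r : ℝ) : ℂ) * (x + Y * Complex.I))) *
          arcsinDeriv (x + Y * Complex.I) := by
      have ha' : Continuous fun p : ℝ × ℝ => arcsinDeriv (p.2 + Y * Complex.I) :=
        (continuous_arcsinDeriv_horizontal hY.ne').comp continuous_snd
      apply Continuous.mul (by fun_prop)
      apply continuous_parametric_intervalIntegral_of_continuous'
      simp only [Function.uncurry_def]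
      fun_prop
    have hv1 := hvert (Real.sin c) (by rwa [abs_of_nonneg hk0])
    have hv0 := hvert 0 (by simp)
    rw [hswap]
    have hsplit : ∀ r : ℝ, (r * Complex.exp (Complex.I * ((t * m r : ℝ) : ℂ))) *
        ∫ x in (0 : ℝ)..Real.sin c, Complex.exp (Complex.I * (((R * r : ℝ) : ℂ) * x)) *
          arcsinDeriv x = _ := fun r => by
      rw [integral_exp_mul_arcsinDeriv (Y := Y) hk0 hk1, mul_add, mul_sub, mul_left_comm _ Complex.I,
        mul_left_comm _ Complex.I]
    simp_rw [hsplit]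
    rw [intervalIntegral.integral_add, intervalIntegral.integral_sub,
      intervalIntegral.integral_const_mul, intervalIntegral.integral_const_mul]
    · refine (norm_add_le _ _).trans ?_
      refine (add_le_add (norm_sub_le _ _) le_rfl).trans ?_
      rw [norm_mul, norm_mul, Complex.norm_I, one_mul, one_mul]
      have e1 := H.norm_horizontal_le (t := t) hR0 hk0 hk1 hY
      have e2 := H.norm_vertical_le ht hR hk0 hk1 hY.le
      have e3 := H.norm_vertical_le ht hR le_rfl zero_lt_one hY.le
      calc _ ≤ 3 * Λ ^ 2 * Y ^ (-1 / 2 : ℝ) + 300 * (Λ / (l * √(μ * Λ))) / |t| +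
            300 * (Λ / (l * √(μ * Λ))) / |t| := add_le_add (add_le_add e1 e2) e3
        _ = _ := by ring
    · exact hhor.intervalIntegrable _ _
    · exact (hv1.const_mul Complex.I).intervalIntegrable _ _
    · exact (hhor.sub (hv1.const_mul Complex.I)).intervalIntegrable _ _
    · exact (hv0.const_mul Complex.I).intervalIntegrable _ _
  have hlim : Filter.Tendsto
      (fun Y : ℝ => 3 * Λ ^ 2 * Y ^ (-1 / 2 : ℝ) + 600 * (Λ / (l * √(μ * Λ))) / |t|)
      Filter.atTop (nhds (3 * Λ ^ 2 * 0 + 600 * (Λ / (l * √(μ * Λ))) / |t|)) := by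
    have h := tendsto_rpow_neg_atTop (y := 1 / 2) (by norm_num)
    rw [show -(1 / 2 : ℝ) = -1 / 2 by norm_num] at h
    exact (h.const_mul _).add_const _
  rw [mul_zero, zero_add] at hlim
  exact ge_of_tendsto hlim (Filter.eventually_atTop.2 ⟨1, fun Y hY => key Y (by linarith)⟩)

/-- The two regimes of |R| are combined by adding their bounds. -/
theorem norm_integral_arc_le (H : IsDyadicPhase m m₁ m₂ Λ μ l) {t c : ℝ} (R : ℝ) (ht : t ≠ 0)
    (hc : 0 ≤ c) (hc' : c ≤ Real.pi / 2) :
    ‖∫ ψ in (0 : ℝ)..c, radialIntegral m Λ R t ψ‖ ≤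
      (80 * (Λ / μ) + 600 * (Λ / (l * √(μ * Λ)))) / |t| := by
  have hΛ := H.pos
  have hμ := H.slope_pos
  have hl := H.curv_pos
  have ht0 := abs_pos.2 ht
  rw [add_div]
  rcases le_total |R| (|t| * μ / 2) with h | h
  · have h1 := intervalIntegral.norm_integral_le_of_norm_le_const (a := 0) (b := c)
      (f := radialIntegral m Λ R t) (fun ψ _ => H.norm_radialIntegral_le ht h ψ)
    rw [sub_zero, abs_of_nonneg hc] at h1
    have h2 : c ≤ 2 := by linarith [Real.pi_le_four]
    calc _ ≤ 40 * (Λ / μ) / |t| * 2 := h1.trans (by gcongr)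
      _ = 80 * (Λ / μ) / |t| := by ring
      _ ≤ _ := le_add_of_nonneg_right (by positivity)
  · refine le_trans ?_ (le_add_of_nonneg_left (by positivity))
    have hlt : ∀ c, 0 ≤ c → c < Real.pi / 2 →
        ‖∫ ψ in (0 : ℝ)..c, radialIntegral m Λ R t ψ‖ ≤ 600 * (Λ / (l * √(μ * Λ))) / |t| := by
      intro c hc hc'
      rcases le_total 0 R with hR | hR
      · rw [abs_of_nonneg hR] at h
        exact H.norm_integral_arc_le_of_large ht h hc hc'
      -- Conjugation reverses the signs of R and t together, reducing negative R to the case already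
      -- treated.
      · rw [abs_of_nonpos hR, ← abs_neg t] at h
        have := H.norm_integral_arc_le_of_large (neg_ne_zero.2 ht) h hc hc'
        simp_rw [radialIntegral_conj] at this
        rwa [intervalIntegral_conj, RCLike.norm_conj, abs_neg] at this
    rcases hc'.lt_or_eq with hlt' | rfl
    · exact hlt c hc hlt'
    -- The full quarter arc ends at the branch point and is reached as a limit of shorter arcs.
    · have hcont : Continuous fun c => ‖∫ ψ in (0 : ℝ)..c, radialIntegral m Λ R t ψ‖ :=
        (continuous_primitive
          (fun a b => (continuous_radialIntegral H.cont Λ R t).intervalIntegrable a b) 0).norm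
      have hpi : (0 : ℝ) < Real.pi / 2 := by positivity
      refine le_of_tendsto (hcont.continuousWithinAt (s := Iio (Real.pi / 2))
        (x := Real.pi / 2)) ?_
      filter_upwards [self_mem_nhdsWithin, mem_nhdsWithin_of_mem_nhds (lt_mem_nhds hpi)]
        with x hx1 hx2
      exact hlt x hx2.le hx1

/-- The arc bound on arcs `[0, c]` with `c ≤ π`. -/
theorem norm_integral_arc_le_pi (H : IsDyadicPhase m m₁ m₂ Λ μ l) {t c : ℝ} (R : ℝ) (ht : t ≠ 0)
    (hc : 0 ≤ c) (hc' : c ≤ Real.pi) :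
    ‖∫ ψ in (0 : ℝ)..c, radialIntegral m Λ R t ψ‖ ≤
      3 * ((80 * (Λ / μ) + 600 * (Λ / (l * √(μ * Λ)))) / |t|) := by
  have hint : ∀ a b, IntervalIntegrable (radialIntegral m Λ R t) volume a b := fun a b =>
    (continuous_radialIntegral H.cont Λ R t).intervalIntegrable a b
  have hpi : (0 : ℝ) < Real.pi / 2 := by positivity
  have e1 := H.norm_integral_arc_le R ht hpi.le le_rfl
  have hM := (norm_nonneg _).trans e1
  rcases le_total c (Real.pi / 2) with h | h
  · linarith [H.norm_integral_arc_le R ht hc h]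
  · have e2 := H.norm_integral_arc_le R ht (c := Real.pi - c) (by linarith) (by linarith)
    -- Reflection about π/2 turns the excess into a difference of two arcs starting at 0, hence
    -- three arcs in all.
    have hrefl : ∫ ψ in (Real.pi / 2)..c, radialIntegral m Λ R t ψ =
        ∫ ψ in (Real.pi - c)..(Real.pi / 2), radialIntegral m Λ R t ψ := by
      have := integral_comp_sub_left (a := Real.pi / 2) (b := c) (radialIntegral m Λ R t) Real.pi
      simp_rw [radialIntegral_pi_sub] at this
      rw [this]
      congr 1
      ring
    rw [← integral_add_adjacent_intervals (hint 0 (Real.pi / 2)) (hint _ c), hrefl,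
      ← integral_interval_sub_left (hint 0 (Real.pi / 2)) (hint 0 (Real.pi - c))]
    refine (norm_add_le _ _).trans ?_
    have := norm_sub_le (∫ ψ in (0 : ℝ)..(Real.pi / 2), radialIntegral m Λ R t ψ)
      (∫ ψ in (0 : ℝ)..(Real.pi - c), radialIntegral m Λ R t ψ)
    linarith

/-- Oscillatory integrals over half circles. -/
theorem norm_integral_half_circle_le (H : IsDyadicPhase m m₁ m₂ Λ μ l) {t a : ℝ} (R : ℝ)
    (ht : t ≠ 0) (ha : -Real.pi ≤ a) (ha' : a ≤ Real.pi) :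
    ‖∫ ψ in a..(a + Real.pi), radialIntegral m Λ R t ψ‖ ≤
      6 * ((80 * (Λ / μ) + 600 * (Λ / (l * √(μ * Λ)))) / |t|) := by
  have hpi := Real.pi_pos
  -- Cut the half circle at 0 and reflect the negative part, which replaces R by -R. A positive
  -- starting angle reduces to this by a shift of π, again flipping R.
  have main : ∀ R a : ℝ, -Real.pi ≤ a → a ≤ 0 →
      ‖∫ ψ in a..(a + Real.pi), radialIntegral m Λ R t ψ‖ ≤
      6 * ((80 * (Λ / μ) + 600 * (Λ / (l * √(μ * Λ)))) / |t|) := by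
    intro R a ha ha'
    have hint : ∀ a b, IntervalIntegrable (radialIntegral m Λ R t) volume a b := fun a b =>
      (continuous_radialIntegral H.cont Λ R t).intervalIntegrable a b
    have e1 := H.norm_integral_arc_le_pi R ht (c := a + Real.pi) (by linarith) (by linarith)
    have e2 := H.norm_integral_arc_le_pi (-R) ht (c := -a) (by linarith) (by linarith)
    have hrefl : ∫ ψ in a..0, radialIntegral m Λ R t ψ =
        ∫ ψ in (0 : ℝ)..(-a), radialIntegral m Λ (-R) t ψ := by
      simp_rw [← radialIntegral_neg]
      rw [integral_comp_neg (radialIntegral m Λ R t)]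
      simp
    rw [← integral_add_adjacent_intervals (hint a 0) (hint 0 _), hrefl]
    refine (norm_add_le _ _).trans ?_
    linarith
  rcases le_total a 0 with h | h
  · exact main R a ha h
  · have := main (-R) (a - Real.pi) (by linarith) (by linarith)
    rw [show a - Real.pi + Real.pi = a + Real.pi - Real.pi by ring,
      ← integral_comp_sub_right (radialIntegral m Λ (-R) t) Real.pi] at this
    simp_rw [radialIntegral_sub_pi, neg_neg] at this
    exact this

end IsDyadicPhase

end FDKP

/-! ### Polar coordinates and the kernel bound. -/

namespace FDKP

open Set MeasureTheory intervalIntegral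

theorem integral_plane_eq_polar (G : Plane → ℂ) :
    ∫ ξ, G ξ = ∫ p in Ioi (0 : ℝ) ×ˢ Ioo (-Real.pi) Real.pi,
      p.1 • G (WithLp.toLp 2 ![p.1 * Real.cos p.2, p.1 * Real.sin p.2]) := by
  rw [← (PiLp.volume_preserving_toLp (Fin 2)).integral_comp
    (MeasurableEquiv.toLp 2 (Fin 2 → ℝ)).measurableEmbedding G,
    ← (volume_preserving_finTwoArrow ℝ).symm.integral_comp
      (MeasurableEquiv.measurableEmbedding _), ← integral_comp_polarCoord_symm]
  rfl

theorem measurable_sign : Measurable Real.sign := by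
  have : Real.sign = fun r : ℝ => if r < 0 then (-1 : ℝ) else if 0 < r then 1 else 0 := rfl
  rw [this]
  exact Measurable.ite measurableSet_Iio measurable_const
    (Measurable.ite measurableSet_Ioi measurable_const measurable_const)

/-- The frequency annulus `Λ/2 ≤ |ξ| ≤ 2Λ`. -/
def annulus (Λ : ℝ) : Set Plane := {ξ | ‖ξ‖ ∈ Icc (Λ / 2) (2 * Λ)}

theorem isCompact_annulus (Λ : ℝ) : IsCompact (annulus Λ) := by
  refine (isCompact_closedBall (0 : Plane) (2 * Λ)).of_isClosed_subset
    (isClosed_Icc.preimage continuous_norm) fun ξ hξ => ?_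
  rw [mem_closedBall_zero_iff]
  exact hξ.2

theorem measurableSet_annulus (Λ : ℝ) : MeasurableSet (annulus Λ) :=
  (isCompact_annulus Λ).isClosed.measurableSet

/-- The unimodular symbol of the propagator, multiplied by a plane wave. -/
noncomputable def wave (m : ℝ → ℝ) (t : ℝ) (x ξ : Plane) : ℂ :=
  Complex.exp (Complex.I * ((inner ℝ x ξ : ℝ) : ℂ) +
    Complex.I * ((t * Real.sign (ξ 0) * m ‖ξ‖ : ℝ) : ℂ))

theorem norm_wave (m : ℝ → ℝ) (t : ℝ) (x ξ : Plane) : ‖wave m t x ξ‖ = 1 := by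
  rw [wave, ← mul_add, ← Complex.ofReal_add, Complex.norm_exp_I_mul_ofReal]

theorem norm_polar {r : ℝ} (θ : ℝ) (hr : 0 < r) :
    ‖(WithLp.toLp 2 ![r * Real.cos θ, r * Real.sin θ] : Plane)‖ = r := by
  rw [EuclideanSpace.norm_eq, Fin.sum_univ_two]
  simp only [Real.norm_eq_abs, sq_abs, Matrix.cons_val_zero, Matrix.cons_val_one]
  rw [show (r * Real.cos θ) ^ 2 + (r * Real.sin θ) ^ 2 = r ^ 2 by
    rw [mul_pow, mul_pow, ← mul_add, add_comm, Real.sin_sq_add_cos_sq, mul_one]]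
  exact Real.sqrt_sq hr.le

theorem wave_polar (m : ℝ → ℝ) (t : ℝ) (x : Plane) {r : ℝ} (θ : ℝ) (hr : 0 < r) :
    wave m t x (WithLp.toLp 2 ![r * Real.cos θ, r * Real.sin θ]) =
      Complex.exp (Complex.I * (((x 0 * Real.cos θ + x 1 * Real.sin θ) * r +
        t * Real.sign (Real.cos θ) * m r : ℝ) : ℂ)) := by
  have hsign : Real.sign (r * Real.cos θ) = Real.sign (Real.cos θ) := by
    rcases lt_trichotomy (Real.cos θ) 0 with h | h | h
    · rw [Real.sign_of_neg h, Real.sign_of_neg (mul_neg_of_pos_of_neg hr h)]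
    · rw [h, mul_zero]
    · rw [Real.sign_of_pos h, Real.sign_of_pos (mul_pos hr h)]
  rw [wave, norm_polar θ hr, ← mul_add, ← Complex.ofReal_add]
  congr 3
  simp only [PiLp.inner_apply, Fin.sum_univ_two, Matrix.cons_val_zero, Matrix.cons_val_one,
    hsign]
  simp only [RCLike.inner_apply, conj_trivial]
  ring

/-- The kernel of the propagator localised to the annulus of radius `Λ`. -/
noncomputable def kernel (m : ℝ → ℝ) (Λ t : ℝ) (x : Plane) : ℂ :=
  ∫ ξ in annulus Λ, wave m t x ξ

theorem periodic_radialIntegral (m : ℝ → ℝ) (Λ R t : ℝ) :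
    Function.Periodic (radialIntegral m Λ R t) (2 * Real.pi) := fun ψ => by
  simp only [radialIntegral, Real.sin_add_two_pi]

namespace IsDyadicPhase

variable {m m₁ m₂ : ℝ → ℝ} {Λ μ l : ℝ}

theorem norm_integral_half_circle_le' (H : IsDyadicPhase m m₁ m₂ Λ μ l) {t : ℝ} (R a : ℝ)
    (ht : t ≠ 0) :
    ‖∫ ψ in a..(a + Real.pi), radialIntegral m Λ R t ψ‖ ≤
      6 * ((80 * (Λ / μ) + 600 * (Λ / (l * √(μ * Λ)))) / |t|) := by
  have hper : Function.Periodic (fun a => ∫ ψ in a..(a + Real.pi), radialIntegral m Λ R t ψ)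
      (2 * Real.pi) := fun a => by
    simp only
    rw [show a + 2 * Real.pi + Real.pi = a + Real.pi + 2 * Real.pi by ring,
      ← integral_comp_add_right (radialIntegral m Λ R t) (2 * Real.pi)]
    simp_rw [periodic_radialIntegral m Λ R t _]
  obtain ⟨b, hb, hab⟩ := hper.exists_mem_Ico (by positivity) a (-Real.pi)
  rw [hab]
  exact H.norm_integral_half_circle_le R ht hb.1 (by linarith [hb.2])

/-- Dispersive decay of the localised kernel. -/
theorem norm_kernel_le (H : IsDyadicPhase m m₁ m₂ Λ μ l) {t : ℝ} (x : Plane) (ht : t ≠ 0) :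
    ‖kernel m Λ t x‖ ≤ 12 * ((80 * (Λ / μ) + 600 * (Λ / (l * √(μ * Λ)))) / |t|) := by
  have hΛ := H.pos
  have hpi := Real.pi_pos
  have hm := H.cont
  -- The coordinates of x are swapped so that x₀ cos θ + x₁ sin θ becomes R sin(θ + γ).
  obtain ⟨R, γ, hR0, hR1⟩ : ∃ R γ : ℝ, R * Real.sin γ = x 0 ∧ R * Real.cos γ = x 1 :=
    ⟨‖(⟨x 1, x 0⟩ : ℂ)‖, Complex.arg ⟨x 1, x 0⟩, Complex.norm_mul_sin_arg _,
      Complex.norm_mul_cos_arg _⟩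
  set F : ℝ × ℝ → ℂ := fun p => (p.1 : ℂ) * Complex.exp (Complex.I *
    ((R * Real.sin (p.2 + γ) * p.1 + t * Real.sign (Real.cos p.2) * m p.1 : ℝ) : ℂ)) with hF
  have hpolar : kernel m Λ t x =
      ∫ p in Icc (Λ / 2) (2 * Λ) ×ˢ Ioo (-Real.pi) Real.pi, F p := by
    have hset : Icc (Λ / 2) (2 * Λ) ×ˢ Ioo (-Real.pi) Real.pi =
        (Ioi (0 : ℝ) ×ˢ Ioo (-Real.pi) Real.pi) ∩
          (Prod.fst ⁻¹' Icc (Λ / 2) (2 * Λ) : Set (ℝ × ℝ)) := by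
      ext p
      simp only [mem_prod, mem_inter_iff, mem_preimage, mem_Ioi, mem_Icc]
      constructor
      · rintro ⟨⟨h1, h2⟩, h3⟩
        exact ⟨⟨by linarith, h3⟩, h1, h2⟩
      · rintro ⟨⟨_, h3⟩, h1⟩
        exact ⟨h1, h3⟩
    rw [kernel, ← MeasureTheory.integral_indicator (measurableSet_annulus Λ),
      integral_plane_eq_polar, hset, ← setIntegral_indicator (measurable_fst measurableSet_Icc)]
    refine setIntegral_congr_fun (measurableSet_Ioi.prod measurableSet_Ioo) fun p hp => ?_
    have hr : 0 < p.1 := hp.1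
    have hw := wave_polar m t x p.2 hr
    have hn := norm_polar p.2 hr
    simp only [indicator, annulus, mem_ofPred_eq, mem_preimage, hn, hw]
    split_ifs
    · simp only [hF, Complex.real_smul]
      congr 5
      rw [Real.sin_add, ← hR0, ← hR1]
      ring
    · exact smul_zero _
  have hint : Integrable F ((volume.restrict (Icc (Λ / 2) (2 * Λ))).prod
      (volume.restrict (Ioo (-Real.pi) Real.pi))) := by
    rw [Measure.prod_restrict]
    apply Measure.integrableOn_of_bounded (M := 2 * Λ)
    · rw [Measure.prod_prod]
      exact ENNReal.mul_ne_top measure_Icc_lt_top.ne measure_Ioo_lt_top.ne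
    · have := measurable_sign
      apply Measurable.aestronglyMeasurable
      simp only [hF]
      fun_prop
    · filter_upwards [ae_restrict_mem (measurableSet_Icc.prod measurableSet_Ioo)] with p hp
      simp only [hF]
      rw [norm_mul, Complex.norm_exp_I_mul_ofReal, mul_one, Complex.norm_real, Real.norm_eq_abs,
        abs_of_nonneg (by linarith [hp.1.1])]
      exact hp.1.2
  have hinner : ∀ θ, ∫ r in Icc (Λ / 2) (2 * Λ), F (r, θ) =
      radialIntegral (fun r => Real.sign (Real.cos θ) * m r) Λ R t (θ + γ) := fun θ => by
    rw [integral_Icc_eq_integral_Ioc, ← integral_of_le (by linarith)]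
    simp only [radialIntegral, hF, mul_assoc]
  set f : ℝ → ℂ := fun θ => radialIntegral (fun r => Real.sign (Real.cos θ) * m r) Λ R t (θ + γ)
    with hf
  have hfint : IntegrableOn f (Ioo (-Real.pi) Real.pi) := by
    have := hint.integral_prod_right
    simp_rw [hinner] at this
    exact this
  have hfI : IntervalIntegrable f volume (-Real.pi) Real.pi := by
    rw [intervalIntegrable_iff_integrableOn_Ioo_of_le (by linarith)]
    exact hfint
  have hfpos : ∀ θ, 0 < Real.cos θ → f θ = radialIntegral m Λ R t (θ + γ) := fun θ hθ => by
    simp only [hf, Real.sign_of_pos hθ, one_mul]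
  have hfneg : ∀ θ, Real.cos θ < 0 → f θ = radialIntegral m Λ R (-t) (θ + γ) := fun θ hθ => by
    simp only [hf, Real.sign_of_neg hθ, radialIntegral]
    simp
  have hcont := fun t => continuous_radialIntegral hm Λ R t
  -- The left half circle, where cos θ < 0 turns t into -t, meets (-π, π) in two quarter arcs;
  -- 2π-periodicity glues them into one arc of length π.
  have hmain : kernel m Λ t x =
      (∫ ψ in (Real.pi / 2 + γ)..(Real.pi / 2 + γ + Real.pi), radialIntegral m Λ R (-t) ψ) +
      ∫ ψ in (-(Real.pi / 2) + γ)..(-(Real.pi / 2) + γ + Real.pi), radialIntegral m Λ R t ψ := by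
    have i1 : IntervalIntegrable f volume (-Real.pi) (-(Real.pi / 2)) := hfI.mono_set (by
      rw [uIcc_of_le (by linarith), uIcc_of_le (by linarith)]
      exact Icc_subset_Icc_right (by linarith))
    have i2 : IntervalIntegrable f volume (-(Real.pi / 2)) (Real.pi / 2) := hfI.mono_set (by
      rw [uIcc_of_le (by linarith), uIcc_of_le (by linarith)]
      exact Icc_subset_Icc (by linarith) (by linarith))
    have i3 : IntervalIntegrable f volume (Real.pi / 2) Real.pi := hfI.mono_set (by
      rw [uIcc_of_le (by linarith), uIcc_of_le (by linarith)]
      exact Icc_subset_Icc_left (by linarith))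
    have e1 : ∫ θ in (-Real.pi)..(-(Real.pi / 2)), f θ =
        ∫ ψ in (Real.pi + γ)..(Real.pi / 2 + γ + Real.pi), radialIntegral m Λ R (-t) ψ := by
      rw [integral_congr_Ioo_of_le (g := fun θ => radialIntegral m Λ R (-t) (θ + γ))
        (by linarith) (fun θ hθ => hfneg θ (by
          rw [← Real.cos_neg]
          exact Real.cos_neg_of_pi_div_two_lt_of_lt (by linarith [hθ.2]) (by linarith [hθ.1])))]
      rw [integral_comp_add_right (radialIntegral m Λ R (-t)) γ]
      rw [show Real.pi + γ = -Real.pi + γ + 2 * Real.pi by ring,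
        show Real.pi / 2 + γ + Real.pi = -(Real.pi / 2) + γ + 2 * Real.pi by ring,
        ← integral_comp_add_right (radialIntegral m Λ R (-t)) (2 * Real.pi)]
      simp_rw [periodic_radialIntegral m Λ R (-t) _]
    have e2 : ∫ θ in (-(Real.pi / 2))..(Real.pi / 2), f θ =
        ∫ ψ in (-(Real.pi / 2) + γ)..(-(Real.pi / 2) + γ + Real.pi),
          radialIntegral m Λ R t ψ := by
      rw [integral_congr_Ioo_of_le (g := fun θ => radialIntegral m Λ R t (θ + γ))
        (by linarith) (fun θ hθ => hfpos θ (Real.cos_pos_of_mem_Ioo hθ))]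
      rw [integral_comp_add_right (radialIntegral m Λ R t) γ]
      congr 1
      ring
    have e3 : ∫ θ in (Real.pi / 2)..Real.pi, f θ =
        ∫ ψ in (Real.pi / 2 + γ)..(Real.pi + γ), radialIntegral m Λ R (-t) ψ := by
      rw [integral_congr_Ioo_of_le (g := fun θ => radialIntegral m Λ R (-t) (θ + γ))
        (by linarith) (fun θ hθ => hfneg θ
          (Real.cos_neg_of_pi_div_two_lt_of_lt hθ.1 (by linarith [hθ.2])))]
      rw [integral_comp_add_right (radialIntegral m Λ R (-t)) γ]
    rw [hpolar, Measure.volume_eq_prod, ← Measure.prod_restrict, integral_prod_symm _ hint]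
    simp_rw [hinner]
    rw [← integral_Ioc_eq_integral_Ioo, ← integral_of_le (by linarith),
      ← integral_add_adjacent_intervals (i1.trans i2) i3,
      ← integral_add_adjacent_intervals i1 i2, e1, e2, e3,
      ← integral_add_adjacent_intervals (b := Real.pi + γ)
        ((hcont (-t)).intervalIntegrable (Real.pi / 2 + γ) (Real.pi + γ))
        ((hcont (-t)).intervalIntegrable (Real.pi + γ) (Real.pi / 2 + γ + Real.pi))]
    ring
  rw [hmain]
  have b1 := H.norm_integral_half_circle_le' R (Real.pi / 2 + γ) (neg_ne_zero.2 ht)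
  have b2 := H.norm_integral_half_circle_le' R (-(Real.pi / 2) + γ) ht
  rw [abs_neg] at b1
  refine (norm_add_le _ _).trans ?_
  linarith

end IsDyadicPhase

end FDKP

/-! ### Sizes on a dyadic shell, Fourier inversion and the convolution formula. -/

namespace FDKP

open Set MeasureTheory

/-- On Λ/2 ≤ r ≤ 2Λ one has √(1 + βr²) ≥ ⟨√βΛ⟩/2, √(tanh r / r) ≥ 1/(2⟨Λ⟩^{1/2}) and 1 + r² ≤ 4⟨Λ⟩².
Multiplying these into the pointwise bounds gives the constants 1/8 and c/32. -/
theorem exists_isDyadicPhase {β : ℝ} (hβ : β = 0 ∨ β = 1) : ∃ c : ℝ, 0 < c ∧ ∀ Λ : ℝ, 0 < Λ →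
    IsDyadicPhase (fun r => √(symbolSq β r)) (symbol₁ β) (symbol₂ β) Λ
      (bracket (√β * Λ) / (8 * √(bracket Λ)))
      √(c * Λ * bracket (√β * Λ) / (32 * √(bracket Λ) ^ 5)) := by
  have hβ0 : 0 ≤ β := by rcases hβ with rfl | rfl <;> norm_num
  obtain ⟨c, hc, hcurv⟩ : ∃ c : ℝ, 0 < c ∧
      ((∀ r, 0 < r → c * (√(Real.tanh r / r) * r * √(1 + β * r ^ 2) / (1 + r ^ 2)) ≤ symbol₂ β r) ∨
      ∀ r, 0 < r → c * (√(Real.tanh r / r) * r * √(1 + β * r ^ 2) / (1 + r ^ 2)) ≤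
        -symbol₂ β r) := by
    rcases hβ with rfl | rfl
    · obtain ⟨c, hc, h⟩ := symbol₂_zero_bound
      exact ⟨c, hc, Or.inr h⟩
    · exact ⟨1 / 8, by norm_num, Or.inl symbol₂_one_bound⟩
  refine ⟨c, hc, fun Λ hΛ => ?_⟩
  have hB : bracket (√β * Λ) = √(1 + β * Λ ^ 2) := by
    rw [bracket, sq_abs, mul_pow, Real.sq_sqrt hβ0]
  have hBpos : 0 < bracket (√β * Λ) := Real.sqrt_pos.2 (by positivity)
  have hJpos : 0 < bracket Λ := Real.sqrt_pos.2 (by positivity)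
  have hJ2 : bracket Λ ^ 2 = 1 + Λ ^ 2 := by
    rw [bracket, Real.sq_sqrt (by positivity), sq_abs]
  have hgpos : 0 < √(bracket Λ) := Real.sqrt_pos.2 hJpos
  have hg2 : √(bracket Λ) ^ 2 = bracket Λ := Real.sq_sqrt hJpos.le
  have hbr : ∀ r ∈ Icc (Λ / 2) (2 * Λ), 0 < r ∧ bracket (√β * Λ) / 2 ≤ √(1 + β * r ^ 2) ∧
      1 / (2 * √(bracket Λ)) ≤ √(Real.tanh r / r) ∧ 1 + r ^ 2 ≤ 4 * bracket Λ ^ 2 := by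
    rintro r ⟨h1, h2⟩
    have hr : 0 < r := by linarith
    refine ⟨hr, ?_, ?_, ?_⟩
    · apply Real.le_sqrt_of_sq_le
      rw [div_pow, hB, Real.sq_sqrt (by positivity)]
      have : (Λ / 2) ^ 2 ≤ r ^ 2 := by gcongr
      nlinarith [mul_le_mul_of_nonneg_left this hβ0]
    · apply Real.le_sqrt_of_sq_le
      rw [div_pow, mul_pow, hg2]
      have h3 : 1 + r ≤ 4 * bracket Λ := by
        have : (1 + r) ^ 2 ≤ (4 * bracket Λ) ^ 2 := by
          rw [mul_pow, hJ2]
          have h5 : r ^ 2 ≤ (2 * Λ) ^ 2 := by gcongr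
          nlinarith [sq_nonneg (r - 1)]
        exact le_of_sq_le_sq this (by positivity)
      have h4 : 1 / (1 + r) ≤ Real.tanh r / r := by
        rw [le_div_iff₀ hr, one_div_mul_eq_div]
        exact div_one_add_le_tanh hr.le
      refine le_trans ?_ h4
      norm_num
      rw [← one_div, ← one_div]
      calc 1 / bracket Λ * (1 / 4) = 1 / (4 * bracket Λ) := by field_simp
        _ ≤ 1 / (1 + r) := by gcongr
    · rw [hJ2]
      nlinarith
  have hcurv' : ∀ r ∈ Icc (Λ / 2) (2 * Λ),
      √(c * Λ * bracket (√β * Λ) / (32 * √(bracket Λ) ^ 5)) ^ 2 ≤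
        c * (√(Real.tanh r / r) * r * √(1 + β * r ^ 2) / (1 + r ^ 2)) := fun r hr => by
    obtain ⟨h0, h1, h2, h3⟩ := hbr r hr
    rw [Real.sq_sqrt (by positivity)]
    calc _ = c * (1 / (2 * √(bracket Λ)) * (Λ / 2) * (bracket (√β * Λ) / 2) /
          (4 * (√(bracket Λ) ^ 2) ^ 2)) := by field_simp; ring
      _ ≤ _ := by
          rw [hg2]
          gcongr
          exact hr.1
  exact
    { pos := hΛ
      slope_pos := by positivity
      curv_pos := by positivity
      cont := (continuous_symbolSq β).sqrt
      deriv := fun r hr => hasDerivAt_sqrt_symbolSq hβ0 (hbr r hr).1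
      deriv2 := fun r hr => hasDerivAt_symbol₁ hβ0 (hbr r hr).1
      cont2 := (continuousOn_symbol₂ hβ0).mono fun r hr => (hbr r hr).1
      slope := fun r hr => by
        obtain ⟨h0, h1, h2, h3⟩ := hbr r hr
        refine le_trans ?_ (sqrt_mul_sqrt_le_symbol₁ hβ0 h0)
        calc _ = 1 / 2 * (bracket (√β * Λ) / 2) * (1 / (2 * √(bracket Λ))) := by
              field_simp; norm_num
          _ ≤ _ := by gcongr
      curv := hcurv.imp (fun h r hr => (hcurv' r hr).trans (h r (hbr r hr).1))
        (fun h r hr => (hcurv' r hr).trans (h r (hbr r hr).1)) }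

/-- The kernel estimate for the symbol, in terms of brackets. -/
theorem exists_norm_kernel_le {β : ℝ} (hβ : β = 0 ∨ β = 1) : ∃ c : ℝ, 0 < c ∧
    ∀ Λ : ℝ, 0 < Λ → ∀ t : ℝ, t ≠ 0 → ∀ x : Plane,
      ‖kernel (fun r => √(symbolSq β r)) Λ t x‖ ≤
        c * (bracket (√β * Λ))⁻¹ * bracket Λ ^ (3 / 2 : ℝ) * |t|⁻¹ := by
  obtain ⟨c, hc, h⟩ := exists_isDyadicPhase hβ
  refine ⟨12 * (640 + 9600 / √c), by positivity, fun Λ hΛ t ht x => ?_⟩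
  refine ((h Λ hΛ).norm_kernel_le x ht).trans ?_
  have hBpos : 0 < bracket (√β * Λ) := Real.sqrt_pos.2 (by positivity)
  have hJpos : 0 < bracket Λ := Real.sqrt_pos.2 (by positivity)
  have hΛJ : Λ ≤ bracket Λ := by
    apply Real.le_sqrt_of_sq_le
    rw [sq_abs]
    linarith
  have hgpos : 0 < √(bracket Λ) := Real.sqrt_pos.2 hJpos
  have hg2 : √(bracket Λ) ^ 2 = bracket Λ := Real.sq_sqrt hJpos.le
  have hg3 : bracket Λ ^ (3 / 2 : ℝ) = √(bracket Λ) ^ 3 := by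
    rw [Real.sqrt_eq_rpow, ← Real.rpow_natCast, ← Real.rpow_mul hJpos.le]
    norm_num
  rw [hg3]
  rw [← hg2] at hΛJ
  generalize √(bracket Λ) = g at *
  generalize bracket (√β * Λ) = B at *
  have hsc : 0 < √c := Real.sqrt_pos.2 hc
  -- With g = ⟨Λ⟩^{1/2}, the non-stationary term loses by Λ ≤ g², whereas the stationary term in
  -- `e3` scales exactly as g³/B.
  have e1 : Λ / (B / (8 * g)) ≤ 8 * (g ^ 3 / B) := by
    calc Λ / (B / (8 * g)) = 8 * (Λ * g / B) := by field_simp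
      _ ≤ 8 * (g ^ 2 * g / B) := by gcongr
      _ = 8 * (g ^ 3 / B) := by ring
  have e2 : √(c * Λ * B / (32 * g ^ 5)) * √(B / (8 * g) * Λ) = √c / 16 * (Λ * B / g ^ 3) := by
    rw [← Real.sqrt_mul (by positivity)]
    rw [show c * Λ * B / (32 * g ^ 5) * (B / (8 * g) * Λ) = c * (1 / 16 * (Λ * B / g ^ 3)) ^ 2 by
      field_simp; norm_num]
    rw [Real.sqrt_mul hc.le, Real.sqrt_sq (by positivity)]
    ring
  have e3 : Λ / (√(c * Λ * B / (32 * g ^ 5)) * √(B / (8 * g) * Λ)) = 16 / √c * (g ^ 3 / B) := by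
    rw [e2]
    field_simp
  rw [e3]
  calc _ ≤ 12 * ((80 * (8 * (g ^ 3 / B)) + 600 * (16 / √c * (g ^ 3 / B))) / |t|) := by gcongr
    _ = _ := by ring

theorem continuous_invHat {g : Plane → ℂ} (hg : Integrable g) : Continuous (invHat g) := by
  refine continuous_of_dominated (bound := fun ξ => ‖g ξ‖) (fun x => ?_) (fun x => ?_) hg.norm ?_
  · exact (Continuous.aestronglyMeasurable (by fun_prop)).mul hg.aestronglyMeasurable
  · refine Filter.Eventually.of_forall fun ξ => ?_
    rw [norm_mul, Complex.norm_exp_I_mul_ofReal, one_mul]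
  · refine Filter.Eventually.of_forall fun ξ => ?_
    fun_prop

theorem hat_eq_invHat_neg (f : Plane → ℂ) (ξ : Plane) :
    hat f ξ = (((2 * Real.pi) ^ 2 : ℝ) : ℂ)⁻¹ * invHat f (-ξ) := by
  rw [hat, invHat]
  congr 2
  ext x
  rw [inner_neg_left, real_inner_comm]
  push_cast
  ring_nf

theorem continuous_hat {f : Plane → ℂ} (hf : Integrable f) : Continuous (hat f) := by
  rw [funext (hat_eq_invHat_neg f)]
  exact continuous_const.mul ((continuous_invHat hf).comp continuous_neg)

open scoped FourierTransform in
theorem invHat_eq_fourierInv (g : Plane → ℂ) (x : Plane) :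
    invHat g x = 𝓕⁻ g ((2 * Real.pi)⁻¹ • x) := by
  rw [Real.fourierInv_eq', invHat]
  congr 1
  ext ξ
  rw [smul_eq_mul, inner_smul_right, real_inner_comm]
  congr 2
  have := Real.pi_ne_zero
  rw [mul_comm, ← mul_assoc, mul_inv_cancel₀ (by positivity), one_mul]

open scoped FourierTransform in
/-- Fourier inversion in the angular frequency normalisation. -/
theorem hat_invHat {g : Plane → ℂ} (hc : Continuous g) (hg : Integrable g)
    (hi : Integrable (invHat g)) : hat (invHat g) = g := by
  have hpi : (0 : ℝ) < 2 * Real.pi := by positivity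
  -- The forward transform is a reflected dilation of `invHat g`, so the two are integrable
  -- together.
  have hF : Integrable (𝓕 g) := by
    have h1 : 𝓕 g = fun v => invHat g ((-(2 * Real.pi)) • v) := by
      ext v
      rw [invHat_eq_fourierInv, smul_smul, mul_neg, inv_mul_cancel₀ hpi.ne', neg_one_smul,
        Real.fourierInv_eq_fourier_neg, neg_neg]
    rw [h1]
    exact hi.comp_smul (by linarith : -(2 * Real.pi) < 0).ne
  ext ξ
  have h2 : ∫ x : Plane, Complex.exp (-(Complex.I * ((inner ℝ x ξ : ℝ) : ℂ))) * invHat g x =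
      ∫ x : Plane, (fun y => Complex.exp (((-2 * Real.pi * inner ℝ y ξ : ℝ) : ℂ) * Complex.I) •
        𝓕⁻ g y) ((2 * Real.pi)⁻¹ • x) := by
    congr 1
    ext x
    simp only
    rw [invHat_eq_fourierInv, smul_eq_mul, inner_smul_left]
    congr 2
    have : -2 * Real.pi * ((starRingEnd ℝ) (2 * Real.pi)⁻¹ * inner ℝ x ξ) = -inner ℝ x ξ := by
      rw [conj_trivial]
      field_simp
    rw [this]
    push_cast
    ring
  have h3 := Measure.integral_comp_smul (volume : Measure Plane)
    (fun y => Complex.exp (((-2 * Real.pi * inner ℝ y ξ : ℝ) : ℂ) * Complex.I) • 𝓕⁻ g y)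
    (2 * Real.pi)⁻¹
  rw [hat, h2, h3, ← Real.fourier_eq', hc.fourier_fourierInv_eq hg hF,
    finrank_euclideanSpace_fin, abs_of_pos (by positivity), Complex.real_smul, ← mul_assoc]
  have : ((((2 * Real.pi) ^ 2 : ℝ) : ℂ)) ≠ 0 := by
    exact_mod_cast (by positivity : (2 * Real.pi) ^ 2 ≠ 0)
  rw [inv_pow, inv_inv, inv_mul_cancel₀ this, one_mul]

/-- Below 1/2 both cutoffs equal 1 and cancel; above 2 both vanish. This support property is what
places `P_Λ f` in the annulus. -/
theorem rho_eq_zero {χ : ℝ → ℝ} (hχ : IsCutoff χ) {s : ℝ} (hs : 0 ≤ s)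
    (h : s ∉ Icc (1 / 2 : ℝ) 2) : rho χ s = 0 := by
  have hout : ∀ s, 2 < s → χ s = 0 := fun s hs => by
    by_contra hne
    have := hχ.support_subset (subset_tsupport _ hne)
    linarith [this.2]
  rw [rho]
  by_cases h1 : s < 1 / 2
  · rw [hχ.eq_one s ⟨by linarith, by linarith⟩, hχ.eq_one (2 * s) ⟨by linarith, by linarith⟩,
      sub_self]
  · have h2 : 2 < s := by
      by_contra h3
      exact h ⟨not_lt.1 h1, not_lt.1 h3⟩
    rw [hout s h2, hout (2 * s) (by linarith), sub_self]

theorem continuous_localised {χ : ℝ → ℝ} (hχ : IsCutoff χ) (Λ : ℝ) {f : Plane → ℂ}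
    (hf : Integrable f) : Continuous fun ξ : Plane => (rho χ (‖ξ‖ / Λ) : ℂ) * hat f ξ := by
  have h1 := hχ.smooth.continuous
  have h2 := continuous_hat hf
  unfold rho
  fun_prop

theorem localised_eq_zero {χ : ℝ → ℝ} (hχ : IsCutoff χ) {Λ : ℝ} (hΛ : 0 < Λ) (f : Plane → ℂ)
    {ξ : Plane} (hξ : ξ ∉ annulus Λ) : (rho χ (‖ξ‖ / Λ) : ℂ) * hat f ξ = 0 := by
  rw [rho_eq_zero hχ (by positivity), Complex.ofReal_zero, zero_mul]
  rintro ⟨h1, h2⟩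
  rw [le_div_iff₀ hΛ] at h1
  rw [div_le_iff₀ hΛ] at h2
  exact hξ ⟨by linarith, h2⟩

theorem measurable_wave {m : ℝ → ℝ} (hm : Continuous m) (t : ℝ) :
    Measurable fun p : Plane × Plane => wave m t p.1 p.2 := by
  have := measurable_sign
  have h0 : Measurable fun p : Plane × Plane => p.2 0 := by fun_prop
  unfold wave
  fun_prop

/-- The propagator acts on band-limited functions by convolution with the localised kernel. -/
theorem propagator_eq_integral_kernel {m : ℝ → ℝ} (hm : Continuous m) {Λ t : ℝ} {P : Plane → ℂ}
    (hP : Integrable P) (hsupp : ∀ ξ, ξ ∉ annulus Λ → hat P ξ = 0) (x : Plane) :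
    propagator m t P x =
      (((2 * Real.pi) ^ 2 : ℝ) : ℂ)⁻¹ * ∫ y, P y * kernel m Λ t (x - y) := by
  have h1 : propagator m t P x = ∫ ξ in annulus Λ, wave m t x ξ * hat P ξ := by
    rw [setIntegral_eq_integral_of_forall_compl_eq_zero]
    · rfl
    · intro ξ hξ
      rw [hsupp ξ hξ, mul_zero]
  have h2 : ∀ ξ y : Plane, wave m t x ξ *
      (Complex.exp (-(Complex.I * ((inner ℝ y ξ : ℝ) : ℂ))) * P y) =
        P y * wave m t (x - y) ξ := fun ξ y => by
    rw [wave, wave, ← mul_assoc, ← Complex.exp_add, mul_comm, inner_sub_left]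
    congr 2
    push_cast
    ring
  have hfin : IsFiniteMeasure (volume.restrict (annulus Λ)) :=
    ⟨by rw [Measure.restrict_apply_univ]; exact (isCompact_annulus Λ).measure_lt_top⟩
  have hint : Integrable (Function.uncurry fun ξ y : Plane => P y * wave m t (x - y) ξ)
      ((volume.restrict (annulus Λ)).prod volume) := by
    refine (hP.comp_snd _).mul_bdd (c := 1) ?_ (Filter.Eventually.of_forall fun p => ?_)
    · exact ((measurable_wave hm t).comp
        (f := fun p : Plane × Plane => (x - p.2, p.1)) (by fun_prop)).aestronglyMeasurable
    · exact (norm_wave _ _ _ _).le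
  calc propagator m t P x = ∫ ξ in annulus Λ, (((2 * Real.pi) ^ 2 : ℝ) : ℂ)⁻¹ *
        ∫ y, P y * wave m t (x - y) ξ := by
        rw [h1]
        congr 1
        ext ξ
        rw [hat, mul_left_comm, ← integral_const_mul]
        simp_rw [h2]
    _ = _ := by
        rw [integral_const_mul, integral_integral_swap hint]
        simp_rw [integral_const_mul]
        rfl

end FDKP

theorem theorem1p1 (χ : ℝ → ℝ) (hχ : FDKP.IsCutoff χ) (β : ℝ) (hβ : β = 0 ∨ β = 1) :
    ∃ c : ℝ, 0 < c ∧
      ∀ (k : ℤ) (Λ : ℝ), Λ = (2 : ℝ) ^ k →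
      ∀ f : SchwartzMap FDKP.Plane ℂ,
      ∀ t : ℝ, t ≠ 0 →
        MeasureTheory.eLpNorm
            (FDKP.propagator (FDKP.symbol β) t (FDKP.lpProj χ Λ f)) ⊤ MeasureTheory.volume
          ≤ ENNReal.ofReal
              (c * (FDKP.bracket (Real.sqrt β * Λ))⁻¹ * (FDKP.bracket Λ) ^ (3 / 2 : ℝ) * |t|⁻¹)
            * MeasureTheory.eLpNorm (FDKP.lpProj χ Λ f) 1 MeasureTheory.volume := by
  have hβ0 : 0 ≤ β := by rcases hβ with rfl | rfl <;> norm_num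
  obtain ⟨c, hc, hker⟩ := FDKP.exists_norm_kernel_le hβ
  refine ⟨c, hc, fun k Λ hk f t ht => ?_⟩
  have hΛ : 0 < Λ := hk ▸ zpow_pos two_pos k
  have hB : 0 < FDKP.bracket (√β * Λ) := Real.sqrt_pos.2 (by positivity)
  have hJ : 0 < FDKP.bracket Λ := Real.sqrt_pos.2 (by positivity)
  have ht0 := abs_pos.2 ht
  have hf : MeasureTheory.Integrable f := f.integrable
  have hgc := FDKP.continuous_localised hχ Λ hf
  have hgi : MeasureTheory.Integrable
      fun ξ : FDKP.Plane => (FDKP.rho χ (‖ξ‖ / Λ) : ℂ) * FDKP.hat f ξ :=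
    hgc.integrable_of_hasCompactSupport (HasCompactSupport.intro (FDKP.isCompact_annulus Λ)
      fun ξ hξ => FDKP.localised_eq_zero hχ hΛ f hξ)
  have hPc : Continuous (FDKP.lpProj χ Λ f) := FDKP.continuous_invHat hgi
  set P := FDKP.lpProj χ Λ f with hP
  set N := c * (FDKP.bracket (√β * Λ))⁻¹ * (FDKP.bracket Λ) ^ (3 / 2 : ℝ) * |t|⁻¹ with hN
  have hN0 : 0 < N := by positivity
  -- If P is not integrable, the right-hand side is infinite. This dispenses with proving decay of
  -- P, while integrability is what Fourier inversion requires.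
  by_cases hPi : MeasureTheory.Integrable P
  · have hhat : FDKP.hat P = _ := FDKP.hat_invHat hgc hgi hPi
    have hm := (FDKP.continuous_symbolSq β).sqrt
    have hprop : FDKP.propagator (FDKP.symbol β) t P =
        FDKP.propagator (fun r => √(FDKP.symbolSq β r)) t P := by
      ext x
      simp only [FDKP.propagator, FDKP.symbol_eq_sqrt_of_nonneg hβ0 (norm_nonneg _)]
    have hbound : ∀ x, ‖FDKP.propagator (FDKP.symbol β) t P x‖ ≤ N * ∫ y, ‖P y‖ := fun x => by
      rw [hprop, FDKP.propagator_eq_integral_kernel hm hPi (Λ := Λ) (fun ξ hξ => by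
        rw [hhat]
        exact FDKP.localised_eq_zero hχ hΛ f hξ), norm_mul, ← MeasureTheory.integral_const_mul]
      -- The factor (2π)⁻² is simply discarded, so the constant is that of the kernel bound and does
      -- not depend on χ.
      have h1 : ‖((((2 * Real.pi) ^ 2 : ℝ) : ℂ))⁻¹‖ ≤ 1 := by
        rw [norm_inv, Complex.norm_real, Real.norm_eq_abs, abs_of_pos (by positivity)]
        exact inv_le_one_of_one_le₀ (one_le_pow₀ (by linarith [Real.pi_gt_three]))
      refine (mul_le_of_le_one_left (norm_nonneg _) h1).trans ?_
      refine MeasureTheory.norm_integral_le_of_norm_le (hPi.norm.const_mul N)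
        (Filter.Eventually.of_forall fun y => ?_)
      rw [norm_mul, mul_comm]
      exact mul_le_mul_of_nonneg_right (hker Λ hΛ t ht (x - y)) (norm_nonneg _)
    rw [MeasureTheory.eLpNorm_exponent_top]
    refine (MeasureTheory.eLpNormEssSup_le_of_ae_bound
      (Filter.Eventually.of_forall hbound)).trans (le_of_eq ?_)
    rw [ENNReal.ofReal_mul hN0.le, MeasureTheory.eLpNorm_one_eq_lintegral_enorm,
      MeasureTheory.ofReal_integral_norm_eq_lintegral_enorm hPi]
  · have htop : MeasureTheory.eLpNorm P 1 MeasureTheory.volume = ⊤ := by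
      by_contra h
      exact hPi (MeasureTheory.memLp_one_iff_integrable.1
        ⟨hPc.aestronglyMeasurable, lt_top_iff_ne_top.2 h⟩)
    rw [htop, ENNReal.mul_top (by simpa using hN0)]
    exact le_top
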